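/- Let $a,b,c$ be $4\times 4$ integer matrices with $a,c$ symmetric and let $Q(x,y)=x^{T}ax+x^{T}by+y^{T}cy$ for $x,y\in\mathbf{Z}^4$. Suppose that $Q$ is generic, that is, $\det(ab)\neq 0$ and the matrix $\Delta:=4b^{-1}ab^{-T}c-I$ has four distinct eigenvalues in $\overline{\mathbf{Q}}$, none of which is $0$ or $-1$. For a commutative ring $R$ in which $\det b$ is a unit, regard $a$, $b$, $c$ and $\Delta$ as matrices over $R$, put $B:=-2b^{-1}ab^{-T}$, and let $$g:=\begin{pmatrix}-2b^{-T}c & b^{-T}\\ 4ab^{-T}c-b & -2ab^{-T}\end{pmatrix}\in\mathrm{Sp}_8(R),$$ where $\mathrm{Sp}_8(R)$ consists of the block matrices $\begin{pmatrix}X&Y\\Z&W\end{pmatrix}$ with $X^TZ=Z^TX$, $Y^TW=W^TY$ and $X^TW-Z^TY=I$. For a unit $r$ of $R$ and $h=\begin{pmatrix}X&Y\\Z&W\end{pmatrix}\in\mathrm{Sp}_8(R)$ write $h^{(r)}:=\begin{pmatrix}X&r^{-1}Y\\rZ&W\end{pmatrix}\in\mathrm{Sp}_8(R)$ and $h^{-(r)}:=(h^{(r)})^{-1}$.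 For a prime $p\nmid\det b$ let $\Gamma_p\leq\mathrm{Sp}_8(\mathbf{F}_p)\leq\mathrm{GL}_8(\mathbf{F}_p)$ be the group generated by the elements $g^{-(r)}g^{(s)}$, $r,s\in\mathbf{F}_p^{*}$ (here $R=\mathbf{F}_p$). Let $\mathbf{F}_p[\Delta]\subseteq\mathrm{Mat}_4(\mathbf{F}_p)$ be the commutative $\mathbf{F}_p$-algebra generated by $\Delta$, and let $\mathrm{SL}_2(\mathbf{F}_p[\Delta])\leq\mathrm{GL}_8(\mathbf{F}_p)$ be the group of $2\times 2$ matrices over $\mathbf{F}_p[\Delta]$ with determinant $1$ in $\mathbf{F}_p[\Delta]$, written out as $8\times 8$ matrices over $\mathbf{F}_p$. Then there is $p_0=p_0(Q)$ such that, for every prime $p\geq p_0$: $p\nmid\det b$; the matrix $\tau:=\begin{pmatrix}I&0\\0&B\end{pmatrix}$ lies in $\mathrm{GL}_8(\mathbf{F}_p)$; $$\Gamma_p=\tau^{-1}\,\mathrm{SL}_2(\mathbf{F}_p[\Delta])\,\tau\quad\text{in }\mathrm{GL}_8(\mathbf{F}_p);$$ and there are positive integers $n_1,\dots,n_k$ with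 $n_1+\dots+n_k=4$ such that $\Gamma_p\cong\prod_{i=1}^k\mathrm{SL}_2(\mathbf{F}_{p^{n_i}})$. Moreover, $|\Gamma_p|\sim p^{12}$: for every $\varepsilon>0$ there is $p_1=p_1(Q,\varepsilon)$ such that $\bigl||\Gamma_p|/p^{12}-1\bigr|\leq\varepsilon$ for every prime $p\geq p_1$. -/

import Mathlib

open Matrix

/-- The form `Q(x, y) = xᵀ a x + xᵀ b y + yᵀ c y` on `ℤ⁴ × ℤ⁴`, with integer `4 × 4` matrices
`a, b, c`, where `a` and `c` are symmetric. -/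
structure SplitQuadForm where
  a : Matrix (Fin 4) (Fin 4) ℤ
  b : Matrix (Fin 4) (Fin 4) ℤ
  c : Matrix (Fin 4) (Fin 4) ℤ
  a_symm : a.IsSymm
  c_symm : c.IsSymm

/-- `GL₈(R)`, with `8 × 8` matrices written as `2 × 2` block matrices of `4 × 4` blocks. -/
abbrev GL8 (R : Type*) [CommRing R] : Type _ := GL (Fin 4 ⊕ Fin 4) R

/-- `Sp₈(R)`. By `Matrix.SymplecticGroup.fromBlocks_mem_iff` it consists of the block matrices
`(A, B; C, D)` with `Aᵀ C = Cᵀ A`, `Bᵀ D = Dᵀ B` and `Aᵀ D - Cᵀ B = I`. -/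
abbrev Sp8 (R : Type*) [CommRing R] : Type _ := Matrix.symplecticGroup (Fin 4) R

/-- The inclusion of `Sp₈(R)` in `GL₈(R)`. -/
def Sp8.toGL8 (R : Type*) [CommRing R] : Sp8 R →* GL8 R :=
  (Matrix.symplecticGroup (Fin 4) R).subtype.toHomUnits

/-- The dilate of `(A, B; C, D)` by `r`, namely `(A, r⁻¹ B; r C, D)`. -/
def Sp8.dilate {R : Type*} [CommRing R] (r : Rˣ) (g : Sp8 R) : Sp8 R :=
  ⟨fromBlocks g.1.toBlocks₁₁ (r⁻¹ • g.1.toBlocks₁₂) (r • g.1.toBlocks₂₁) g.1.toBlocks₂₂, by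
    have h := g.2
    rw [← fromBlocks_toBlocks g.1, SymplecticGroup.fromBlocks_mem_iff] at h
    rw [SymplecticGroup.fromBlocks_mem_iff]
    obtain ⟨h1, h2, h3⟩ := h
    simp only [transpose_smul, Matrix.smul_mul, Matrix.mul_smul, smul_smul]
    refine ⟨by rw [h1], by rw [h2], by simpa using h3⟩⟩

/-- For a `4 × 4` matrix `D` over `R`, the group `SL₂(R[D])` realised in `GL₈(R)`: the `8 × 8`
block matrices whose four blocks lie in the commutative algebra `R[D]` and whose determinant as a
`2 × 2` matrix over `R[D]` is `1`. -/
noncomputable def SL2AdjoinToGL8 {R : Type*} [CommRing R] (D : Matrix (Fin 4) (Fin 4) R) :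
    SpecialLinearGroup (Fin 2) (Algebra.adjoin R {D}) →* GL8 R :=
  MonoidHom.toHomUnits
    { toFun := fun M => fromBlocks (M.1 0 0 : Matrix (Fin 4) (Fin 4) R) (M.1 0 1) (M.1 1 0) (M.1 1 1)
      map_one' := by simp [fromBlocks_one]
      map_mul' := fun M N => by
        simp [fromBlocks_multiply, Matrix.mul_apply, Fin.sum_univ_two] }

namespace SplitQuadForm

/-- The value `Q(x, y)`. -/
def eval (Q : SplitQuadForm) (x y : Fin 4 → ℤ) : ℤ :=
  x ⬝ᵥ (Q.a *ᵥ x) + x ⬝ᵥ (Q.b *ᵥ y) + y ⬝ᵥ (Q.c *ᵥ y)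

/-- The matrix `a` viewed over a commutative ring `R`. -/
def aOver (Q : SplitQuadForm) (R : Type*) [CommRing R] : Matrix (Fin 4) (Fin 4) R :=
  Q.a.map (Int.cast : ℤ → R)

/-- The matrix `b` viewed over a commutative ring `R`. -/
def bOver (Q : SplitQuadForm) (R : Type*) [CommRing R] : Matrix (Fin 4) (Fin 4) R :=
  Q.b.map (Int.cast : ℤ → R)

/-- The matrix `c` viewed over a commutative ring `R`. -/
def cOver (Q : SplitQuadForm) (R : Type*) [CommRing R] : Matrix (Fin 4) (Fin 4) R :=
  Q.c.map (Int.cast : ℤ → R)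

/-- The matrix discriminant `Δ = 4 b⁻¹ a b⁻ᵀ c - I` over `R`
(meaningful when `det b` is a unit of `R`). -/
noncomputable def Delta (Q : SplitQuadForm) (R : Type*) [CommRing R] : Matrix (Fin 4) (Fin 4) R :=
  (4 : R) • ((Q.bOver R)⁻¹ * Q.aOver R * (Q.bOver R)⁻¹ᵀ * Q.cOver R) - 1

/-- The matrix `B = -2 b⁻¹ a b⁻ᵀ` over `R` (meaningful when `det b` is a unit of `R`). -/
noncomputable def B (Q : SplitQuadForm) (R : Type*) [CommRing R] : Matrix (Fin 4) (Fin 4) R :=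
  -((2 : R) • ((Q.bOver R)⁻¹ * Q.aOver R * (Q.bOver R)⁻¹ᵀ))

/-- `Q` is generic: `det (a b) ≠ 0`, and `Δ` has four distinct eigenvalues in the algebraic closure
of `ℚ`, none of them `0` or `-1`. -/
def IsGeneric (Q : SplitQuadForm) : Prop :=
  (Q.a * Q.b).det ≠ 0 ∧
    {μ : AlgebraicClosure ℚ | Module.End.HasEigenvalue
      (toLin' ((Q.Delta ℚ).map (algebraMap ℚ (AlgebraicClosure ℚ)))) μ}.ncard = 4 ∧
    ∀ μ : AlgebraicClosure ℚ, Module.End.HasEigenvalue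
      (toLin' ((Q.Delta ℚ).map (algebraMap ℚ (AlgebraicClosure ℚ)))) μ → μ ≠ 0 ∧ μ ≠ -1

/-- The symplectic element `g = (-2 b⁻ᵀ c, b⁻ᵀ; 4 a b⁻ᵀ c - b, -2 a b⁻ᵀ)` of `Q` over `R`, when
`det b` is a unit of `R`. -/
noncomputable def symplecticElement (Q : SplitQuadForm) (R : Type*) [CommRing R]
    (hb : IsUnit (Q.bOver R).det) : Sp8 R :=
  ⟨fromBlocks
      (-((2 : R) • ((Q.bOver R)⁻¹ᵀ * Q.cOver R)))
      ((Q.bOver R)⁻¹ᵀ)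
      ((4 : R) • (Q.aOver R * (Q.bOver R)⁻¹ᵀ * Q.cOver R) - Q.bOver R)
      (-((2 : R) • (Q.aOver R * (Q.bOver R)⁻¹ᵀ))), by
    have ha : (Q.aOver R)ᵀ = Q.aOver R := by
      rw [aOver, ← transpose_map, Q.a_symm.eq]
    have hc : (Q.cOver R)ᵀ = Q.cOver R := by
      rw [cOver, ← transpose_map, Q.c_symm.eq]
    have h1 : (Q.bOver R)⁻¹ * Q.bOver R = 1 := nonsing_inv_mul _ hb
    have h2 : (Q.bOver R)ᵀ * (Q.bOver R)⁻¹ᵀ = 1 := by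
      rw [← transpose_mul, h1, transpose_one]
    rw [SymplecticGroup.fromBlocks_mem_iff]
    generalize Q.aOver R = a at *
    generalize Q.cOver R = c at *
    generalize (Q.bOver R)⁻¹ = d at *
    generalize Q.bOver R = b at *
    simp only [transpose_neg, transpose_sub, transpose_smul, transpose_mul, transpose_transpose,
      ha, hc, Matrix.mul_sub, Matrix.sub_mul, Matrix.smul_mul, Matrix.mul_smul, Matrix.neg_mul,
      Matrix.mul_neg, smul_smul, Matrix.mul_assoc, h1, h2, smul_neg, neg_neg, Matrix.mul_one]
    have h3 : bᵀ * (dᵀ * c) = c := by rw [← Matrix.mul_assoc, h2, Matrix.one_mul]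
    refine ⟨?_, trivial, ?_⟩
    · rw [h3]
      module
    · norm_num⟩

/-- The group `Γ` generated by the elements `g^{-(r)} g^{(s)}`, for `r, s` units of `R`. -/
noncomputable def Gam (Q : SplitQuadForm) (R : Type*) [CommRing R]
    (hb : IsUnit (Q.bOver R).det) : Subgroup (Sp8 R) :=
  Subgroup.closure {γ | ∃ r s : Rˣ,
    γ = ((Q.symplecticElement R hb).dilate r)⁻¹ * (Q.symplecticElement R hb).dilate s}

end SplitQuadForm

/-! Put `A = F_p[Δ]` and let `P_s = (-sΔ, -1; 1 + Δ, s⁻¹)` in `SL₂(A)`. Since `1 + Δ = -2Bc`, every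
dilate factors as `g^{(s)} = C · P_s · τ` with `C` independent of `s`. Hence `g^{-(r)} g^{(s)} = τ⁻¹
P_r⁻¹ P_s τ`, and the question is whether the elements `P_r⁻¹ P_s` generate `SL₂(A)`. For large `p`
the characteristic polynomial of `Δ` stays separable, so `A` is reduced of dimension 4, a product of
finite fields, and `Δ`, `1 + Δ` are units.

Generation (`pencilGroup_eq_top`) is proved by counting, for any finite von Neumann regular `A` of
dimension `n` generated by `x` with `x`, `1 + x` units and `p > 12n + 8`. Let `H` be generated by
the letters `P_s P_r⁻¹`, a conjugate of the group sought, and let `f` be the minimal polynomial of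
`x`. Over `F_p[X]` a product of `k` suitably chosen letters is determined by its first column, and
there are at least `(p-3)^(2k)` such words. For `k = n` the columns stay distinct modulo `f`: two of
them differ in degree at most `n`, with a zero at `0` or `-1`, where `f` does not vanish. So the
`H`-orbit of the first basis vector fills more than half of `A²`, and `HU` (`U` upper unipotent)
more than half of `SL₂(A)`; thus `HU` meets each of its right translates `HUw`.

Taking `w` diagonal shows that the set `I` of entries of `H ∩ U` is stable under squares of units.
As `2xy = (1+x)²y - x²y - y`, it is an ideal. Taking `w` to be the Weyl element gives `H` enough
elementary matrices to contain the congruence subgroup of `I`. If `I ≠ 0`, induction applies to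
`A/I`.

That `I ≠ 0` is a second count (`exists_upper_mem`). If `I = 0`, an element of `H` is determined by
its first column. A word of length `n + 1` sharing its column with a word of length `n` is then
congruent to it in all entries, which at most `2p` words can be (`card_congruent_le`). The few
columns left carry at most `p²` words each, too few for all words of length `n + 1`. -/

namespace SLTwo

/-! ### Elementary matrices and congruence subgroups over von Neumann regular rings -/

section Elementary

variable {R : Type*} [CommRing R]

/-- The unipotent matrix `(1, y; 0, 1)`. -/
def upper (y : R) : SpecialLinearGroup (Fin 2) R :=
  ⟨!![1, y; 0, 1], by simp [det_fin_two]⟩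

/-- The unipotent matrix `(1, 0; y, 1)`. -/
def lower (y : R) : SpecialLinearGroup (Fin 2) R :=
  ⟨!![1, 0; y, 1], by simp [det_fin_two]⟩

/-- The diagonal matrix `(a, 0; 0, a⁻¹)`. -/
def diagUnit (a : Rˣ) : SpecialLinearGroup (Fin 2) R :=
  ⟨!![(a : R), 0; 0, ((a⁻¹ : Rˣ) : R)], by simp [det_fin_two]⟩

/-- The Weyl element `(0, -1; 1, 0)`. -/
def weyl : SpecialLinearGroup (Fin 2) R :=
  ⟨!![0, -1; 1, 0], by simp [det_fin_two]⟩

lemma coe_upper (y : R) : (upper y).1 = !![1, y; 0, 1] := rfl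

lemma coe_lower (y : R) : (lower y).1 = !![1, 0; y, 1] := rfl

lemma coe_diagUnit (a : Rˣ) : (diagUnit a).1 = !![(a : R), 0; 0, ((a⁻¹ : Rˣ) : R)] := rfl

lemma coe_weyl : (weyl : SpecialLinearGroup (Fin 2) R).1 = !![0, -1; 1, 0] := rfl

lemma mul_apply_two (g h : SpecialLinearGroup (Fin 2) R) (i j : Fin 2) :
    (g * h).1 i j = g.1 i 0 * h.1 0 j + g.1 i 1 * h.1 1 j := by
  change (g.1 * h.1) i j = _
  rw [Matrix.mul_apply, Fin.sum_univ_two]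

lemma det_eq (g : SpecialLinearGroup (Fin 2) R) : g.1 0 0 * g.1 1 1 - g.1 0 1 * g.1 1 0 = 1 := by
  rw [← det_fin_two]; exact g.2

lemma ext_of {g h : SpecialLinearGroup (Fin 2) R} (h1 : g.1 0 0 = h.1 0 0)
    (h2 : g.1 0 1 = h.1 0 1) (h3 : g.1 1 0 = h.1 1 0) (h4 : g.1 1 1 = h.1 1 1) : g = h := by
  apply Matrix.SpecialLinearGroup.ext
  intro i j
  fin_cases i <;> fin_cases j <;> assumption

lemma ext_of_isUnit {g h : SpecialLinearGroup (Fin 2) R} (hu : IsUnit (g.1 0 0))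
    (h1 : g.1 0 0 = h.1 0 0) (h2 : g.1 0 1 = h.1 0 1) (h3 : g.1 1 0 = h.1 1 0) : g = h := by
  refine ext_of h1 h2 h3 (hu.mul_left_cancel ?_)
  have hg := det_eq g
  have hh := det_eq h
  rw [← h1, ← h2, ← h3] at hh
  linear_combination hg - hh

lemma upper_add (y z : R) : upper (y + z) = upper y * upper z := by
  apply ext_of <;> simp [mul_apply_two, coe_upper, add_comm]

lemma upper_zero : upper (0 : R) = 1 := by
  apply ext_of <;> simp [coe_upper]

lemma upper_neg (y : R) : upper (-y) = (upper y)⁻¹ := by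
  rw [eq_inv_iff_mul_eq_one, ← upper_add, neg_add_cancel, upper_zero]

lemma upper_injective : Function.Injective (upper : R → SpecialLinearGroup (Fin 2) R) := by
  intro y z h
  simpa [coe_upper] using congrArg (fun g => g.1 0 1) h

lemma diagUnit_conj_upper (a : Rˣ) (y : R) :
    diagUnit a * upper y = upper (a * a * y) * diagUnit a := by
  apply ext_of <;> simp [mul_apply_two, coe_upper, coe_diagUnit]
  rw [mul_right_comm, mul_assoc (a : R), Units.mul_inv, mul_one]

lemma weyl_conj_upper (y : R) : weyl * upper y = lower (-y) * weyl := by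
  apply ext_of <;> simp [mul_apply_two, coe_upper, coe_lower, coe_weyl]

/-- Two elements with the same first column differ by an upper unipotent factor. -/
lemma exists_eq_mul_upper {g h : SpecialLinearGroup (Fin 2) R} (h0 : g.1 0 0 = h.1 0 0)
    (h1 : g.1 1 0 = h.1 1 0) : ∃ y, h = g * upper y := by
  refine ⟨g.1 1 1 * h.1 0 1 - g.1 0 1 * h.1 1 1, ?_⟩
  have hg := det_eq g
  have hh := det_eq h
  rw [← h0, ← h1] at hh
  apply ext_of <;> simp [mul_apply_two, coe_upper, h0, h1]
  · rw [← h0]; linear_combination (-h.1 0 1) * hg + g.1 0 1 * hh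
  · rw [← h1]; linear_combination (-h.1 1 1) * hg + g.1 1 1 * hh

/-- Over a von Neumann regular ring, the congruence subgroup of an ideal is generated by the
elementary matrices with entry in the ideal. -/
lemma mem_of_congr_one (hreg : ∀ a : R, ∃ y, a * a * y = a) (I : Ideal R)
    (N : Subgroup (SpecialLinearGroup (Fin 2) R)) (hu : ∀ y ∈ I, upper y ∈ N)
    (hl : ∀ y ∈ I, lower y ∈ N) (g : SpecialLinearGroup (Fin 2) R)
    (h00 : g.1 0 0 - 1 ∈ I) (h01 : g.1 0 1 ∈ I) (h10 : g.1 1 0 ∈ I) : g ∈ N := by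
  have key : ∀ k : SpecialLinearGroup (Fin 2) R, k.1 0 0 - 1 ∈ I → k.1 0 1 ∈ I → k.1 1 0 ∈ I →
      IsUnit (k.1 0 0) → k ∈ N := by
    intro k k00 k01 k10 hk
    obtain ⟨w, hw⟩ := hk.exists_right_inv
    obtain ⟨y, hy⟩ := hreg (k.1 0 0 - 1)
    obtain ⟨v, hv⟩ : ∃ v, v = k.1 0 0 - 1 := ⟨_, rfl⟩
    have hk0 : k.1 0 0 = 1 + v := by rw [hv]; ring
    rw [← hv] at k00 hy
    rw [hk0] at hw
    -- Row and column elimination leaves `diag(1 + v, w)`. Since `v * v * y = v`, the product `upper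
    -- (v * y) * lower v` has corner `1 + v`, and clearing its off-diagonal entries gives that
    -- diagonal matrix. All parameters are multiples of entries in `I`.
    have e : k = lower (k.1 1 0 * w) * (lower (-(v * w)) * (upper (v * y) * lower v) *
        upper (-(v * y * w))) * upper (k.1 0 1 * w) := by
      apply ext_of_isUnit hk <;> simp [mul_apply_two, coe_upper, coe_lower, hk0]
      · linear_combination -hy
      · linear_combination (-k.1 0 1) * hw + (v * y) * hw - (k.1 0 1 * w) * hy + v*y*w*hy
      · linear_combination (-(k.1 1 0)) * hw + v * hw + (v * w - k.1 1 0 * w) * hy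
    rw [e]
    have hvw : v * w ∈ I := I.mul_mem_right _ k00
    have hvy : v * y ∈ I := I.mul_mem_right _ k00
    exact N.mul_mem (N.mul_mem (hl _ (I.mul_mem_right _ k10)) (N.mul_mem (N.mul_mem
      (hl _ (I.neg_mem hvw)) (N.mul_mem (hu _ hvy) (hl _ k00)))
      (hu _ (I.neg_mem (I.mul_mem_right _ hvy))))) (hu _ (I.mul_mem_right _ k01))
  obtain ⟨y, hy⟩ := hreg (g.1 0 0)
  have hdet := det_eq g
  -- `t` is the idempotent supported where the corner vanishes. There the upper right entry is
  -- invertible because the determinant is 1, so adding `t` times the second column to the first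
  -- makes the corner a unit.
  obtain ⟨t, ht⟩ : ∃ t, t = 1 - g.1 0 0 * y := ⟨_, rfl⟩
  have hat : g.1 0 0 * t = 0 := by rw [ht]; linear_combination -hy
  have htI : t ∈ I := by
    have : t = -t * (g.1 0 0 - 1) := by linear_combination hat
    rw [this]
    exact I.mul_mem_left _ h00
  have hunit : IsUnit (g.1 0 0 + g.1 0 1 * t) := by
    refine IsUnit.of_mul_eq_one (g.1 0 0 * y * y - g.1 1 0 * t) ?_
    linear_combination y * hy + (-g.1 1 0 + g.1 0 1 * y * y - g.1 1 1 * t - y) * hat +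
      t ^ 2 * hdet + (1 + t) * ht
  have h1 : g * lower t ∈ N := by
    apply key <;> simp only [mul_apply_two, coe_lower, of_apply, cons_val', cons_val_zero,
      cons_val_one, cons_val_fin_one, mul_one, mul_zero, zero_add]
    · rw [add_sub_right_comm]
      exact I.add_mem h00 (I.mul_mem_left _ htI)
    · exact h01
    · exact I.add_mem h10 (I.mul_mem_left _ htI)
    · exact hunit
  exact (N.mul_mem_cancel_right (hl _ htI)).1 h1

end Elementary

/-! ### Consequences of a large orbit of the first basis vector -/

section LargeOrbit

variable {A : Type*} [CommRing A]

open Classical in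
lemma card_image_mul_upper [Fintype A] (W : Finset (SpecialLinearGroup (Fin 2) A))
    (hinj : ∀ g ∈ W, ∀ h ∈ W, g.1 0 0 = h.1 0 0 → g.1 1 0 = h.1 1 0 → g = h) :
    ((W ×ˢ (Finset.univ : Finset A)).image fun z => z.1 * upper z.2).card =
      W.card * Fintype.card A := by
  rw [Finset.card_image_of_injOn, Finset.card_product, Finset.card_univ]
  rintro ⟨g, y⟩ hg ⟨h, z⟩ hh e
  simp only [Finset.coe_product, Set.mem_prod, Finset.mem_coe] at hg hh
  have e0 := congrArg (fun g => g.1 0 0) e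
  have e1 := congrArg (fun g => g.1 1 0) e
  simp only [mul_apply_two, coe_upper, of_apply, cons_val', cons_val_zero,
    cons_val_one, cons_val_fin_one, mul_one, mul_zero, add_zero] at e0 e1
  have := hinj g hg.1 h hh.1 e0 e1
  subst this
  simpa using upper_injective (mul_left_cancel e)

/-- Matrices with a common first column lie in one coset `g * U` of size `|A|`, and there are at
most `|A|²` columns. -/
lemma card_SL2_le [Finite A] :
    Nat.card (SpecialLinearGroup (Fin 2) A) ≤ Nat.card A * Nat.card A ^ 2 := by
  classical
  cases nonempty_fintype A
  have : Fintype (SpecialLinearGroup (Fin 2) A) := Fintype.ofFinite _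
  rw [Nat.card_eq_fintype_card, Nat.card_eq_fintype_card]
  have := Finset.card_le_mul_card_image (s := Finset.univ)
    (f := fun g : SpecialLinearGroup (Fin 2) A => (g.1 0 0, g.1 1 0)) (Fintype.card A) (by
      intro v hv
      obtain ⟨g, -, rfl⟩ := Finset.mem_image.1 hv
      rw [← Finset.card_univ (α := A)]
      refine (Finset.card_le_card ?_).trans (Finset.card_image_le (s := Finset.univ)
        (f := fun y : A => g * upper y))
      intro h hh
      obtain ⟨h0, h1⟩ := Prod.mk.inj (Finset.mem_filter.1 hh).2
      obtain ⟨y, hy⟩ := exists_eq_mul_upper h0.symm h1.symm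
      exact Finset.mem_image.2 ⟨y, Finset.mem_univ _, hy.symm⟩)
  rw [Finset.card_univ] at this
  refine this.trans (Nat.mul_le_mul_left _ ((Finset.card_le_univ _).trans ?_))
  rw [Fintype.card_prod, sq]

/-- If the `H`-orbit of the first basis vector has more than half as many elements as `A²`, then
for every `w` some `g` has both `g` and `g * w` in `H * U`, with `U` the upper unipotent group. -/
lemma exists_mem_and_mul_mem [Finite A] (H : Subgroup (SpecialLinearGroup (Fin 2) A))
    (W : Finset (SpecialLinearGroup (Fin 2) A)) (hWH : ∀ h ∈ W, h ∈ H)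
    (hinj : ∀ g ∈ W, ∀ h ∈ W, g.1 0 0 = h.1 0 0 → g.1 1 0 = h.1 1 0 → g = h)
    (hcard : Nat.card A ^ 2 < 2 * W.card) (w : SpecialLinearGroup (Fin 2) A) :
    ∃ h ∈ H, ∃ y, ∃ h' ∈ H, ∃ y', h * upper y * w = h' * upper y' := by
  classical
  cases nonempty_fintype A
  have : Fintype (SpecialLinearGroup (Fin 2) A) := Fintype.ofFinite _
  set T : Finset (SpecialLinearGroup (Fin 2) A) :=
    (W ×ˢ (Finset.univ : Finset A)).image (fun z => z.1 * upper z.2) with hT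
  have hTcard : T.card = W.card * Fintype.card A := card_image_mul_upper W hinj
  have hG := card_SL2_le (A := A)
  rw [Nat.card_eq_fintype_card, Nat.card_eq_fintype_card] at hG
  have hlt : Fintype.card (SpecialLinearGroup (Fin 2) A) < 2 * T.card := by
    have hpos : 0 < Fintype.card A := Fintype.card_pos
    rw [Nat.card_eq_fintype_card] at hcard
    rw [hTcard]
    nlinarith
  -- `T`, the product of `W` with all upper unipotents, exceeds half of the group, so it meets its
  -- translate.
  set T' := T.image (fun g => g * w⁻¹) with hT'
  have hTT' : T'.card = T.card :=
    Finset.card_image_of_injective _ (mul_left_injective _)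
  have hne : (T ∩ T').Nonempty := by
    rw [← Finset.card_pos]
    have h1 := Finset.card_union_add_card_inter T T'
    have h2 : (T ∪ T').card ≤ _ := Finset.card_le_univ _
    omega
  obtain ⟨g, hg⟩ := hne
  obtain ⟨hg, hw⟩ := Finset.mem_inter.1 hg
  obtain ⟨g', hg', e⟩ := Finset.mem_image.1 hw
  simp only [hT, Finset.mem_image, Finset.mem_product, Prod.exists] at hg hg'
  obtain ⟨h, y, ⟨hh, -⟩, rfl⟩ := hg
  obtain ⟨h', y', ⟨hh', -⟩, rfl⟩ := hg'
  exact ⟨h, hWH h hh, y, h', hWH h' hh', y', by rw [← e, inv_mul_cancel_right]⟩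

/-- The entries of the upper unipotent elements of `H`. -/
def upperEntries (H : Subgroup (SpecialLinearGroup (Fin 2) A)) : AddSubgroup A where
  carrier := {y | upper y ∈ H}
  add_mem' := fun {y z} hy hz => by
    rw [Set.mem_ofPred_eq, upper_add]; exact H.mul_mem hy hz
  zero_mem' := by rw [Set.mem_ofPred_eq, upper_zero]; exact H.one_mem
  neg_mem' := fun {y} hy => by
    rw [Set.mem_ofPred_eq, upper_neg]; exact H.inv_mem hy

lemma mem_upperEntries {H : Subgroup (SpecialLinearGroup (Fin 2) A)} {y : A} :
    y ∈ upperEntries H ↔ upper y ∈ H := Iff.rfl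

lemma conj_mem_of_mul_upper {H : Subgroup (SpecialLinearGroup (Fin 2) A)} {h : _} (hh : h ∈ H)
    (z : A) {y : A} (hy : upper y ∈ H) : (h * upper z) * upper y * (h * upper z)⁻¹ ∈ H := by
  have e : (h * upper z) * upper y * (h * upper z)⁻¹ = h * upper y * h⁻¹ := by
    have : upper z * upper y = upper y * upper z := by rw [← upper_add, ← upper_add, add_comm]
    rw [mul_assoc h, this]; group
  rw [e]
  exact H.mul_mem (H.mul_mem hh hy) (H.inv_mem hh)

/-- The entries of the upper unipotent elements of `H` are stable under squares of units when the
orbit of the first basis vector is large. -/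
lemma sq_mul_mem_upperEntries (H : Subgroup (SpecialLinearGroup (Fin 2) A))
    (hH : ∀ w, ∃ h ∈ H, ∃ y, ∃ h' ∈ H, ∃ y', h * upper y * w = h' * upper y') (a : Aˣ) {y : A}
    (hy : y ∈ upperEntries H) : (a : A) * a * y ∈ upperEntries H := by
  -- Conjugation by `h' * upper z'` keeps `upper y` in `H`. The same element equals `h * upper z *
  -- diagUnit a`, so the conjugate is `h * upper (a * a * y) * h⁻¹`, and `h` can be stripped off.
  obtain ⟨h, hh, z, h', hh', z', e⟩ := hH (diagUnit a)
  have h1 := conj_mem_of_mul_upper hh' z' hy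
  rw [← e, mul_assoc _ (diagUnit a), diagUnit_conj_upper] at h1
  have e2 : h * upper z * (upper (a * a * y) * diagUnit a) * (h * upper z * diagUnit a)⁻¹ =
      h * upper (a * a * y) * h⁻¹ := by
    have : upper z * upper (a * a * y) = upper (a * a * y) * upper z := by
      rw [← upper_add, ← upper_add, add_comm]
    rw [← mul_assoc, mul_assoc h, this]; group
  rw [e2] at h1
  have := H.mul_mem (H.mul_mem (H.inv_mem hh) h1) hh
  rw [mem_upperEntries]
  convert this using 1
  group

/-- If the entries of the upper unipotent elements of `H` contain an ideal, and the orbit of the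
first basis vector is large, then `H` contains the congruence subgroup of that ideal. -/
lemma congruence_le (hreg : ∀ a : A, ∃ y, a * a * y = a)
    (H : Subgroup (SpecialLinearGroup (Fin 2) A))
    (hH : ∀ w, ∃ h ∈ H, ∃ y, ∃ h' ∈ H, ∃ y', h * upper y * w = h' * upper y') (I : Ideal A)
    (hI : ∀ y ∈ I, y ∈ upperEntries H) :
    (SpecialLinearGroup.map (n := Fin 2) (Ideal.Quotient.mk I)).ker ≤ H := by
  -- With `g = h * upper z`, the group `g⁻¹ H g` contains the upper matrices with entries in `I`. As
  -- `g * weyl = h' * upper z'`, it contains the lower ones too. The congruence subgroup is normal,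
  -- so this conjugate may replace `H`.
  obtain ⟨h, hh, z, h', hh', z', e⟩ := hH weyl
  intro k hk
  set g := h * upper z
  have hk' : g⁻¹ * k * g ∈ (SpecialLinearGroup.map (n := Fin 2) (Ideal.Quotient.mk I)).ker := by
    simpa using (MonoidHom.normal_ker
      (SpecialLinearGroup.map (n := Fin 2) (Ideal.Quotient.mk I))).conj_mem k hk g⁻¹
  have hc : ∀ i j, (Ideal.Quotient.mk I) ((g⁻¹ * k * g).1 i j) =
      (1 : Matrix (Fin 2) (Fin 2) (A ⧸ I)) i j := fun i j =>
    congrArg (fun m => m.1 i j) (MonoidHom.mem_ker.1 hk')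
  have := mem_of_congr_one hreg I (H.map (MulAut.conj g⁻¹).toMonoidHom) ?_ ?_ (g⁻¹ * k * g)
    ?_ ?_ ?_
  · obtain ⟨m, hm, e⟩ := this
    simp only [MulEquiv.coe_toMonoidHom, MulAut.conj_apply, inv_inv] at e
    have e' : m = k := by simpa using e
    exact e' ▸ hm
  · intro y hy
    refine ⟨g * upper y * g⁻¹, conj_mem_of_mul_upper hh z (hI y hy), ?_⟩
    simp only [MulEquiv.coe_toMonoidHom, MulAut.conj_apply]
    group
  · intro y hy
    have h1 := conj_mem_of_mul_upper hh' z' (hI (-y) (I.neg_mem hy))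
    rw [← e, mul_assoc _ weyl, weyl_conj_upper, neg_neg] at h1
    refine ⟨_, h1, ?_⟩
    simp only [MulEquiv.coe_toMonoidHom, MulAut.conj_apply]
    group
  · rw [← Ideal.Quotient.mk_eq_mk_iff_sub_mem, hc]; simp
  · rw [← Ideal.Quotient.eq_zero_iff_mem, hc]; simp
  · rw [← Ideal.Quotient.eq_zero_iff_mem, hc]; simp

end LargeOrbit
end SLTwo

namespace SLTwo

open Polynomial

/-! ### The pencil and the group it generates -/

section Pencil

variable {F : Type*} [Field F] {R : Type*} [CommRing R] [Algebra F R]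

/-- The matrix `(-s x, -1; 1 + x, s⁻¹)` of determinant `1`. -/
def pencil (x : R) (s : Fˣ) : SpecialLinearGroup (Fin 2) R :=
  ⟨!![-(algebraMap F R s * x), -1; 1 + x, algebraMap F R (s⁻¹ : Fˣ)], by
    have h : algebraMap F R s * algebraMap F R (s⁻¹ : Fˣ) = 1 := by
      rw [← map_mul, Units.mul_inv, map_one]
    rw [det_fin_two]
    simp only [of_apply, cons_val', cons_val_zero, cons_val_one, cons_val_fin_one]
    linear_combination (-x) * h⟩

lemma coe_pencil (x : R) (s : Fˣ) : (pencil x s).1 =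
    !![-(algebraMap F R s * x), -1; 1 + x, algebraMap F R (s⁻¹ : Fˣ)] := rfl

/-- The product `pencil x s * (pencil x r)⁻¹`. -/
def letter (x : R) (r s : Fˣ) : SpecialLinearGroup (Fin 2) R := pencil x s * (pencil x r)⁻¹

lemma coe_pencil_inv (x : R) (s : Fˣ) : ((pencil x s)⁻¹).1 =
    !![algebraMap F R (s⁻¹ : Fˣ), 1; -(1 + x), -(algebraMap F R s * x)] := by
  change adjugate (pencil x s).1 = _
  rw [coe_pencil, adjugate_fin_two_of, neg_neg]

/-- The group generated by the elements `pencil x s * (pencil x r)⁻¹`. -/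
def pencilGroup (F : Type*) [Field F] [Algebra F R] (x : R) :
    Subgroup (SpecialLinearGroup (Fin 2) R) :=
  Subgroup.closure {g | ∃ r s : Fˣ, g = letter x r s}

variable {S : Type*} [CommRing S] [Algebra F S]

lemma map_pencil (f : R →ₐ[F] S) (x : R) (s : Fˣ) :
    SpecialLinearGroup.map (f : R →+* S) (pencil x s) = pencil (f x) s := by
  apply ext_of
  · change f _ = _
    simp [coe_pencil]
  · change f _ = _
    simp [coe_pencil]
  · change f _ = _
    simp [coe_pencil]
  · change f (algebraMap F R (s⁻¹ : Fˣ)) = algebraMap F S (s⁻¹ : Fˣ)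
    simp

lemma map_letter (f : R →ₐ[F] S) (x : R) (r s : Fˣ) :
    SpecialLinearGroup.map (f : R →+* S) (letter x r s) = letter (f x) r s := by
  rw [letter, letter, map_mul, map_inv, map_pencil, map_pencil]

lemma map_pencilGroup (f : R →ₐ[F] S) (x : R) :
    (pencilGroup F x).map (SpecialLinearGroup.map (f : R →+* S)) = pencilGroup F (f x) := by
  rw [pencilGroup, pencilGroup, MonoidHom.map_closure]
  congr 1
  ext g
  constructor
  · rintro ⟨_, ⟨r, s, rfl⟩, rfl⟩
    exact ⟨r, s, map_letter f x r s⟩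
  · rintro ⟨r, s, rfl⟩
    exact ⟨_, ⟨r, s, rfl⟩, map_letter f x r s⟩

end Pencil

/-! ### Words over the polynomial ring and their number -/

section Words

variable {F : Type*} [Field F]

/-- The properties of a product of `k` letters that persist when further letters are added. -/
structure WordProps (k : ℕ) (N : SpecialLinearGroup (Fin 2) F[X]) : Prop where
  degree_le : ∀ i j, (N.1 i j).natDegree ≤ k
  eval_zero₀₀ : (N.1 0 0).eval 0 = 1
  eval_zero₀₁ : (N.1 0 1).eval 0 = 0
  eval_zero₁₁ : (N.1 1 1).eval 0 = 1
  eval_neg_one : (N.1 1 0).eval (-1) = 0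
  lead : (N.1 0 0).coeff k ≠ 0

/-- Letters `(r, s)` that may be put in front of `N`. -/
structure Admissible (k : ℕ) (N : SpecialLinearGroup (Fin 2) F[X]) (r s : Fˣ) : Prop where
  lead : (N.1 0 0).coeff k + r * (N.1 1 0).coeff k ≠ 0
  ne : s ≠ r
  eval_zero : (N.1 1 0).eval 0 + (r⁻¹ : Fˣ) - (s⁻¹ : Fˣ) ≠ 0

lemma wordProps_one : WordProps 0 (1 : SpecialLinearGroup (Fin 2) F[X]) where
  degree_le i j := by
    change ((1 : Matrix (Fin 2) (Fin 2) F[X]) i j).natDegree ≤ 0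
    rw [Matrix.one_apply]; split_ifs <;> simp
  eval_zero₀₀ := by simp
  eval_zero₀₁ := by simp
  eval_zero₁₁ := by simp
  eval_neg_one := by simp
  lead := by simp

/-- At `X = 0` a letter is lower unipotent and at `X = -1` it is upper triangular. The evaluation
conditions in `WordProps` come from this. -/
lemma coe_letter_mul (r s : Fˣ) (N : SpecialLinearGroup (Fin 2) F[X]) (j : Fin 2) :
    (letter X r s * N).1 0 j = N.1 0 j + C (1 - (s : F) * (r⁻¹ : Fˣ)) * (X * N.1 0 j) +
        C ((r : F) - s) * (X * N.1 1 j) ∧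
      (letter X r s * N).1 1 j = C ((r⁻¹ : Fˣ) - (s⁻¹ : Fˣ) : F) * (N.1 0 j + X * N.1 0 j) +
        N.1 1 j + C (1 - (r : F) * (s⁻¹ : Fˣ)) * (X * N.1 1 j) := by
  constructor
  · simp only [letter, mul_apply_two, coe_pencil, coe_pencil_inv, of_apply, cons_val',
      cons_val_zero, cons_val_one, cons_val_fin_one, ← C_eq_algebraMap, C_sub, C_mul, C_1]
    ring
  · simp only [letter, mul_apply_two, coe_pencil, coe_pencil_inv, of_apply, cons_val',
      cons_val_zero, cons_val_one, cons_val_fin_one, ← C_eq_algebraMap, C_sub, C_mul, C_1]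
    ring

/-- The coefficient of `X` in a letter has rank one: it is `r - s` times the column `(1, -s⁻¹)`
times the row `(r⁻¹, 1)`. The leading coefficients of a word therefore reveal `s`. -/
lemma coeff_letter_mul {k : ℕ} (r s : Fˣ) {N : SpecialLinearGroup (Fin 2) F[X]}
    (hN : WordProps k N) (j : Fin 2) :
    ((letter X r s * N).1 0 j).coeff (k + 1) =
        ((r : F) - s) * ((r⁻¹ : Fˣ) * (N.1 0 j).coeff k + (N.1 1 j).coeff k) ∧
      ((letter X r s * N).1 1 j).coeff (k + 1) =
        -((s⁻¹ : Fˣ) : F) * ((letter X r s * N).1 0 j).coeff (k + 1) := by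
  have h0 : (N.1 0 j).coeff (k + 1) = 0 :=
    coeff_eq_zero_of_natDegree_lt (Nat.lt_succ_of_le (hN.degree_le 0 j))
  have h1 : (N.1 1 j).coeff (k + 1) = 0 :=
    coeff_eq_zero_of_natDegree_lt (Nat.lt_succ_of_le (hN.degree_le 1 j))
  have hr : (r : F) * (r⁻¹ : Fˣ) = 1 := Units.mul_inv r
  have hs : (s : F) * (s⁻¹ : Fˣ) = 1 := Units.mul_inv s
  obtain ⟨e0, e1⟩ := coe_letter_mul r s N j
  rw [e0, e1]
  simp only [coeff_add, coeff_C_mul, coeff_X_mul, h0, h1]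
  constructor
  · linear_combination (-(N.1 0 j).coeff k) * hr
  · linear_combination (-(N.1 0 j).coeff k * (r⁻¹ : Fˣ)  - (N.1 1 j).coeff k) * hs

/-- The conditions `lead` and `ne` of admissibility make the degree of the corner grow by exactly
one. The third condition, `eval_zero`, is saved for the nonvanishing used in `card_congruent_le`. -/
lemma WordProps.letter_mul {k : ℕ} {r s : Fˣ} {N : SpecialLinearGroup (Fin 2) F[X]}
    (hN : WordProps k N) (h : Admissible k N r s) : WordProps (k + 1) (letter X r s * N) where
  degree_le i j := by
    have hX : ∀ P : F[X], P.natDegree ≤ k → (X * P).natDegree ≤ k + 1 := fun P hP =>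
      natDegree_mul_le.trans (by rw [natDegree_X]; omega)
    have h0 := hN.degree_le 0 j
    have h1 := hN.degree_le 1 j
    obtain ⟨e0, e1⟩ := coe_letter_mul r s N j
    fin_cases i
    · change ((letter X r s * N).1 0 j).natDegree ≤ _
      rw [e0]
      exact natDegree_add_le_of_degree_le (natDegree_add_le_of_degree_le (by omega)
        ((natDegree_C_mul_le _ _).trans (hX _ h0))) ((natDegree_C_mul_le _ _).trans (hX _ h1))
    · change ((letter X r s * N).1 1 j).natDegree ≤ _
      rw [e1]
      exact natDegree_add_le_of_degree_le (natDegree_add_le_of_degree_le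
        ((natDegree_C_mul_le _ _).trans (natDegree_add_le_of_degree_le (by omega) (hX _ h0)))
        (by omega)) ((natDegree_C_mul_le _ _).trans (hX _ h1))
  eval_zero₀₀ := by simp [(coe_letter_mul r s N 0).1, hN.eval_zero₀₀]
  eval_zero₀₁ := by simp [(coe_letter_mul r s N 1).1, hN.eval_zero₀₁]
  eval_zero₁₁ := by simp [(coe_letter_mul r s N 1).2, hN.eval_zero₁₁, hN.eval_zero₀₁]
  eval_neg_one := by simp [(coe_letter_mul r s N 0).2, hN.eval_neg_one]
  lead := by
    rw [(coeff_letter_mul r s hN 0).1]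
    refine mul_ne_zero (sub_ne_zero.2 fun e => h.ne (Units.ext e.symm)) fun e => h.lead ?_
    have hr : (r : F) * (r⁻¹ : Fˣ) = 1 := Units.mul_inv r
    linear_combination (r : F) * e - (N.1 0 0).coeff k * hr

lemma Admissible.eval_zero_letter_mul_ne {k : ℕ} {r s : Fˣ} {N : SpecialLinearGroup (Fin 2) F[X]}
    (hN : WordProps k N) (h : Admissible k N r s) : ((letter X r s * N).1 1 0).eval 0 ≠ 0 := by
  intro e
  rw [(coe_letter_mul r s N 0).2] at e
  simp only [eval_add, eval_mul, eval_C, eval_X, hN.eval_zero₀₀] at e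
  exact h.eval_zero (by linear_combination e)

/-- The first column of a product determines its first letter and the first column of the rest. -/
lemma letter_mul_cancel {k : ℕ} {r s r' s' : Fˣ} {N N' : SpecialLinearGroup (Fin 2) F[X]}
    (hN : WordProps k N) (h : Admissible k N r s) (hN' : WordProps k N')
    (h' : Admissible k N' r' s')
    (h0 : (letter X r s * N).1 0 0 = (letter X r' s' * N').1 0 0)
    (h1 : (letter X r s * N).1 1 0 = (letter X r' s' * N').1 1 0) :
    r = r' ∧ s = s' ∧ N.1 0 0 = N'.1 0 0 ∧ N.1 1 0 = N'.1 1 0 := by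
  -- The two leading coefficients of the first column have ratio `-s⁻¹`.
  have hs : s = s' := by
    have e := (coeff_letter_mul r s hN 0).2
    have e' := (coeff_letter_mul r' s' hN' 0).2
    rw [h1, h0, e'] at e
    have := mul_right_cancel₀ (hN'.letter_mul h').lead e
    exact inv_injective (Units.ext (neg_injective this.symm))
  subst hs
  have key : ∀ {g g' : SpecialLinearGroup (Fin 2) F[X]} (u : SpecialLinearGroup (Fin 2) F[X]),
      (u * g).1 0 0 = (u * g').1 0 0 → (u * g).1 1 0 = (u * g').1 1 0 →
      g.1 0 0 = g'.1 0 0 ∧ g.1 1 0 = g'.1 1 0 := by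
    intro g g' u e0 e1
    obtain ⟨y, hy⟩ := exists_eq_mul_upper e0 e1
    rw [mul_assoc] at hy
    rw [mul_left_cancel hy]
    simp [mul_apply_two, coe_upper]
  simp only [letter, mul_assoc] at h0 h1
  obtain ⟨e0, e1⟩ := key _ h0 h1
  -- In the column of `(pencil X r)⁻¹ * N`, the coefficient of `X^k` on top is `-r⁻¹` times that of
  -- `X^(k+1)` below, and both are nonzero by `lead`.
  have hr : r = r' := by
    have c0 := congrArg (coeff · k) e0
    have c1 := congrArg (coeff · (k + 1)) e1
    have z : ∀ {M : SpecialLinearGroup (Fin 2) F[X]}, WordProps k M →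
        ∀ i, (M.1 i 0).coeff (k + 1) = 0 :=
      fun hM i => coeff_eq_zero_of_natDegree_lt (Nat.lt_succ_of_le (hM.degree_le i 0))
    simp only [mul_apply_two, coe_pencil_inv, of_apply, cons_val',
      cons_val_zero, cons_val_one, cons_val_fin_one, ← C_eq_algebraMap, coeff_add, coeff_C_mul,
      neg_mul, add_mul, one_mul, coeff_neg, mul_assoc, coeff_X_mul, z hN, z hN'] at c0 c1
    have hr : (r : F) * (r⁻¹ : Fˣ) = 1 := Units.mul_inv r
    have hr' : (r' : F) * (r'⁻¹ : Fˣ) = 1 := Units.mul_inv r'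
    have hl := h.lead
    have : (r⁻¹ : Fˣ) * (((N.1 0 0).coeff k + r * (N.1 1 0).coeff k)) =
      (r'⁻¹ : Fˣ) * (((N.1 0 0).coeff k + r * (N.1 1 0).coeff k)) := by
      linear_combination c0 + (N.1 1 0).coeff k * hr + (r'⁻¹ : Fˣ) * c1 -
        (N'.1 1 0).coeff k * hr'
    exact inv_injective (Units.ext (mul_right_cancel₀ hl this))
  subst hr
  obtain ⟨e0, e1⟩ := key _ e0 e1
  exact ⟨rfl, rfl, e0, e1⟩

open Classical in
/-- The products of `k` letters in which each letter is admissible. -/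
noncomputable def words (F : Type*) [Field F] [Fintype F] :
    ℕ → Finset (SpecialLinearGroup (Fin 2) F[X])
  | 0 => {1}
  | k + 1 => ((words F k).sigma fun N => (Finset.univ : Finset (Fˣ × Fˣ)).filter fun t =>
      Admissible k N t.1 t.2).image fun t => letter X t.2.1 t.2.2 * t.1

variable [Fintype F]

lemma mem_words_succ {k : ℕ} {M : SpecialLinearGroup (Fin 2) F[X]} :
    M ∈ words F (k + 1) ↔ ∃ N ∈ words F k, ∃ r s, Admissible k N r s ∧ M = letter X r s * N := by
  classical
  rw [words, Finset.mem_image]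
  constructor
  · rintro ⟨⟨N, r, s⟩, h, rfl⟩
    rw [Finset.mem_sigma, Finset.mem_filter] at h
    exact ⟨N, h.1, r, s, h.2.2, rfl⟩
  · rintro ⟨N, hN, r, s, h, rfl⟩
    exact ⟨⟨N, r, s⟩, by simpa using ⟨hN, h⟩, rfl⟩

lemma wordProps_of_mem {k : ℕ} {M : SpecialLinearGroup (Fin 2) F[X]} (hM : M ∈ words F k) :
    WordProps k M := by
  induction k generalizing M with
  | zero => rw [words, Finset.mem_singleton] at hM; rw [hM]; exact wordProps_one
  | succ k ih =>
    obtain ⟨N, hN, r, s, h, rfl⟩ := mem_words_succ.1 hM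
    exact (ih hN).letter_mul h

lemma mem_pencilGroup_of_mem_words {k : ℕ} {M : SpecialLinearGroup (Fin 2) F[X]}
    (hM : M ∈ words F k) : M ∈ pencilGroup F (X : F[X]) := by
  induction k generalizing M with
  | zero => rw [words, Finset.mem_singleton] at hM; rw [hM]; exact Subgroup.one_mem _
  | succ k ih =>
    obtain ⟨N, hN, r, s, h, rfl⟩ := mem_words_succ.1 hM
    exact Subgroup.mul_mem _ (Subgroup.subset_closure ⟨r, s, rfl⟩) (ih hN)

lemma words_col_injective {k : ℕ} {M M' : SpecialLinearGroup (Fin 2) F[X]} (hM : M ∈ words F k)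
    (hM' : M' ∈ words F k) (h0 : M.1 0 0 = M'.1 0 0) (h1 : M.1 1 0 = M'.1 1 0) : M = M' := by
  induction k generalizing M M' with
  | zero =>
    rw [words, Finset.mem_singleton] at hM hM'; rw [hM, hM']
  | succ k ih =>
    obtain ⟨N, hN, r, s, h, rfl⟩ := mem_words_succ.1 hM
    obtain ⟨N', hN', r', s', h', rfl⟩ := mem_words_succ.1 hM'
    obtain ⟨rfl, rfl, e0, e1⟩ :=
      letter_mul_cancel (wordProps_of_mem hN) h (wordProps_of_mem hN') h' h0 h1
    rw [ih hN hN' e0 e1]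

-- Among the `|F| - 1` units at most one `r` is excluded, and for each `r` at most two values of
-- `s`.
open Classical in
lemma card_admissible {k : ℕ} {N : SpecialLinearGroup (Fin 2) F[X]} (hN : WordProps k N) :
    (Fintype.card F - 3) ^ 2 ≤ ((Finset.univ : Finset (Fˣ × Fˣ)).filter fun t =>
      Admissible k N t.1 t.2).card := by
  have hu : Fintype.card Fˣ = Fintype.card F - 1 := Fintype.card_units F
  set P := (Finset.univ : Finset Fˣ).filter fun r : Fˣ =>
    ¬ (N.1 0 0).coeff k + r * (N.1 1 0).coeff k = 0 with hP
  have hPc : Fintype.card F - 3 ≤ P.card := by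
    have h1 : ((Finset.univ : Finset Fˣ).filter fun r : Fˣ =>
        (N.1 0 0).coeff k + r * (N.1 1 0).coeff k = 0).card + P.card = _ :=
      Finset.card_filter_add_card_filter_not _
    have h2 : ((Finset.univ : Finset Fˣ).filter fun r : Fˣ =>
        (N.1 0 0).coeff k + r * (N.1 1 0).coeff k = 0).card ≤ 1 := by
      refine Finset.card_le_one.2 fun r hr r' hr' => Units.ext ?_
      have e := (Finset.mem_filter.1 hr).2
      have e' := (Finset.mem_filter.1 hr').2
      have hc : (N.1 1 0).coeff k ≠ 0 := fun hc => hN.lead (by rwa [hc, mul_zero, add_zero] at e)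
      exact mul_right_cancel₀ hc (by linear_combination e - e')
    rw [Finset.card_univ, hu] at h1
    omega
  set Q : Fˣ → Finset Fˣ := fun r => (Finset.univ : Finset Fˣ).filter fun s =>
    ¬ (s = r ∨ (N.1 1 0).eval 0 + (r⁻¹ : Fˣ) - (s⁻¹ : Fˣ) = 0) with hQ
  have hQc : ∀ r, Fintype.card F - 3 ≤ (Q r).card := by
    intro r
    have h1 : ((Finset.univ : Finset Fˣ).filter fun s : Fˣ =>
        s = r ∨ (N.1 1 0).eval 0 + (r⁻¹ : Fˣ) - (s⁻¹ : Fˣ) = 0).card + (Q r).card = _ :=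
      Finset.card_filter_add_card_filter_not _
    have h2 : ((Finset.univ : Finset Fˣ).filter fun s : Fˣ =>
        s = r ∨ (N.1 1 0).eval 0 + (r⁻¹ : Fˣ) - (s⁻¹ : Fˣ) = 0).card ≤ 2 := by
      rw [Finset.filter_or]
      refine (Finset.card_union_le _ _).trans (Nat.add_le_add (b := 1) (d := 1) ?_ ?_)
      · exact Finset.card_le_one.2 fun s hs s' hs' =>
          (Finset.mem_filter.1 hs).2.trans (Finset.mem_filter.1 hs').2.symm
      · refine Finset.card_le_one.2 fun s hs s' hs' => inv_injective (Units.ext ?_)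
        have e := (Finset.mem_filter.1 hs).2
        have e' := (Finset.mem_filter.1 hs').2
        linear_combination e' - e
    rw [Finset.card_univ, hu] at h1
    omega
  calc (Fintype.card F - 3) ^ 2 = (Fintype.card F - 3) * (Fintype.card F - 3) := sq _
    _ ≤ P.card * (Fintype.card F - 3) := Nat.mul_le_mul_right _ hPc
    _ ≤ ∑ r ∈ P, (Q r).card := by
      rw [← smul_eq_mul]; exact Finset.card_nsmul_le_sum _ _ _ fun r _ => hQc r
    _ = (P.sigma Q).card := (Finset.card_sigma _ _).symm
    _ ≤ _ := by
      refine Finset.card_le_card_of_injOn (fun t => (t.1, t.2)) ?_ ?_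
      · rintro ⟨r, s⟩ h
        simp only [hP, hQ, Finset.coe_sigma, Set.mem_sigma_iff, Finset.mem_coe, Finset.mem_filter,
          Finset.mem_univ, true_and, not_or] at h
        simp only [Finset.mem_coe, Finset.mem_filter, Finset.mem_univ, true_and]
        exact ⟨h.1, h.2.1, h.2.2⟩
      · rintro ⟨r, s⟩ - ⟨r', s'⟩ - e
        simp only [Prod.mk.injEq] at e
        obtain ⟨rfl, rfl⟩ := e
        rfl

lemma card_words (k : ℕ) : (Fintype.card F - 3) ^ (2 * k) ≤ (words F k).card := by
  classical
  induction k with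
  | zero => simp [words]
  | succ k ih =>
    rw [words, Finset.card_image_of_injOn, Finset.card_sigma]
    · calc (Fintype.card F - 3) ^ (2 * (k + 1))
          = (Fintype.card F - 3) ^ (2 * k) * (Fintype.card F - 3) ^ 2 := by ring
        _ ≤ (words F k).card * (Fintype.card F - 3) ^ 2 := Nat.mul_le_mul_right _ ih
        _ ≤ _ := by
          rw [← smul_eq_mul]
          exact Finset.card_nsmul_le_sum _ _ _ fun N hN => card_admissible (wordProps_of_mem hN)
    · rintro ⟨N, r, s⟩ h ⟨N', r', s'⟩ h' e
      simp only [Finset.coe_sigma, Set.mem_sigma_iff, Finset.mem_coe, Finset.mem_filter,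
        Finset.mem_univ, true_and] at h h'
      obtain ⟨rfl, rfl, e0, e1⟩ := letter_mul_cancel (wordProps_of_mem h.1) h.2
        (wordProps_of_mem h'.1) h'.2 (congrArg (fun g => g.1 0 0) e)
        (congrArg (fun g => g.1 1 0) e)
      rw [words_col_injective h.1 h'.1 e0 e1]

end Words
end SLTwo

/-! ### Numerical inequalities for the counts -/

namespace SLTwo

open Polynomial

/-- Bernoulli's inequality `(1 - 3/q)^k ≥ 1 - 3k/q` without denominators. -/
lemma pow_mul_sub_le {q : ℝ} (hq : 3 ≤ q) (k : ℕ) : q ^ k * (q - 3 * k) ≤ (q - 3) ^ k * q := by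
  induction k with
  | zero => simp
  | succ k ih =>
    have h0 : (0 : ℝ) ≤ q ^ k := by positivity
    have hk : (0 : ℝ) ≤ k := Nat.cast_nonneg k
    have h1 := mul_le_mul_of_nonneg_left ih (sub_nonneg.2 hq)
    push_cast
    rw [pow_succ, pow_succ]
    nlinarith [mul_nonneg h0 hk]

lemma pow_lt_two_mul_pow {p n : ℕ} (hp : 12 * n + 8 < p) :
    p ^ (2 * n) < 2 * (p - 3) ^ (2 * n) := by
  have h3 : 3 ≤ p := by omega
  have hp' : (12 * n + 8 : ℝ) < p := by exact_mod_cast hp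
  have hq : (3 : ℝ) ≤ p := by exact_mod_cast h3
  have h := pow_mul_sub_le hq (2 * n)
  have hpos : (0 : ℝ) < (p : ℝ) ^ (2 * n) := by positivity
  have : (p : ℝ) ^ (2 * n) < 2 * ((p : ℝ) - 3) ^ (2 * n) := by
    refine lt_of_mul_lt_mul_right ?_ (by positivity : (0 : ℝ) ≤ p)
    push_cast at h
    nlinarith
  have e : ((p - 3 : ℕ) : ℝ) = (p : ℝ) - 3 := by push_cast [h3]; ring
  rw [← e] at this
  exact_mod_cast this

/-- After division by `p^(2n+2)`, Bernoulli bounds the right side below by `2 - (12n+6)/p`, while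
the left side is `1 + 2/p`; this is the source of the threshold `12n + 8`. -/
lemma pow_count_lt {p n : ℕ} (hp : 12 * n + 8 < p) :
    2 * p * p ^ (2 * n) + p ^ (2 * n) * p ^ 2 <
      (p - 3) ^ (2 * (n + 1)) + (p - 3) ^ (2 * n) * p ^ 2 := by
  have h3 : 3 ≤ p := by omega
  have hp' : (12 * n + 8 : ℝ) < p := by exact_mod_cast hp
  have hq : (3 : ℝ) ≤ p := by exact_mod_cast h3
  have h := pow_mul_sub_le hq (2 * n)
  have h' := pow_mul_sub_le hq (2 * (n + 1))
  have hpos : (0 : ℝ) < (p : ℝ) ^ (2 * n) * p ^ 2 := by positivity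
  have : 2 * (p : ℝ) * p ^ (2 * n) + p ^ (2 * n) * p ^ 2 <
      ((p : ℝ) - 3) ^ (2 * (n + 1)) + ((p : ℝ) - 3) ^ (2 * n) * p ^ 2 := by
    refine lt_of_mul_lt_mul_right ?_ (by positivity : (0 : ℝ) ≤ p)
    have h2 := mul_le_mul_of_nonneg_right h (by positivity : (0 : ℝ) ≤ (p : ℝ) ^ 2)
    have e : (p : ℝ) ^ (2 * (n + 1)) = p ^ (2 * n) * p ^ 2 := by ring
    rw [e] at h'
    push_cast at h' h2
    nlinarith [mul_pos hpos (sub_pos.2 hp')]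
  have e : ((p - 3 : ℕ) : ℝ) = (p : ℝ) - 3 := by push_cast [h3]; ring
  rw [← e] at this
  exact_mod_cast this

/-! ### Congruences between words modulo a polynomial -/

section Quadratic

variable {F : Type*} [Field F]

/-- The cofactor of `f` has degree at most 1 and vanishes at `c`, so a single scalar, the top
coefficient, determines it. -/
lemma eq_mul_of_dvd {f P : F[X]} {n : ℕ} (hf : f.Monic) (hn : f.natDegree = n) {c : F}
    (hc : f.eval c ≠ 0) (hd : f ∣ P) (hP : P.natDegree ≤ n + 1) (h0 : P.eval c = 0) :
    P = f * (C (P.coeff (n + 1)) * (X - C c)) := by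
  obtain ⟨Q, rfl⟩ := hd
  by_cases hQ : Q = 0
  · simp [hQ]
  have hQ1 : Q.natDegree ≤ 1 := by
    rw [hf.natDegree_mul' hQ] at hP; omega
  have hco : (f * Q).coeff (n + 1) = Q.coeff 1 := by
    have h : f.coeff n = 1 := by rw [← hn]; exact hf
    rw [coeff_mul_add_eq_of_natDegree_le hn.le hQ1, h, one_mul]
  rw [eval_mul] at h0
  have hQc := (mul_eq_zero.1 h0).resolve_left hc
  rw [hco]
  have e := eq_X_add_C_of_natDegree_le_one hQ1
  rw [e] at hQc
  simp only [eval_add, eval_mul, eval_C, eval_X] at hQc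
  congr 1
  conv_lhs => rw [e]
  have : C (Q.coeff 0) = - (C (Q.coeff 1) * C c) := by
    rw [← C_mul, ← C_neg]; congr 1; linear_combination hQc
  rw [this]; ring

/-- The derivative at 0 of the identity `det N = 1`. -/
lemma WordProps.derivative_eval {k : ℕ} {N : SpecialLinearGroup (Fin 2) F[X]}
    (hN : WordProps k N) : (derivative (N.1 0 0)).eval 0 + (derivative (N.1 1 1)).eval 0 =
      (derivative (N.1 0 1)).eval 0 * (N.1 1 0).eval 0 := by
  have h := congrArg (fun P => (derivative P).eval 0) (det_eq N)
  simp only [derivative_sub, derivative_mul, derivative_one, eval_sub, eval_add, eval_mul,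
    eval_zero, hN.eval_zero₀₀, hN.eval_zero₁₁, hN.eval_zero₀₁] at h
  linear_combination h

lemma WordProps.det_eval {k : ℕ} {N : SpecialLinearGroup (Fin 2) F[X]} (hN : WordProps k N) :
    (N.1 0 0).eval (-1) * (N.1 1 1).eval (-1) = 1 := by
  have h := congrArg (fun P => P.eval (-1)) (det_eq N)
  simpa [hN.eval_neg_one] using h

variable {f : F[X]} {n : ℕ}

lemma col_eq_of_dvd (hf : f.Monic) (hn : f.natDegree = n) (hf0 : f.eval 0 ≠ 0)
    (hf1 : f.eval (-1) ≠ 0)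
    {k k' : ℕ} (hk : k ≤ n + 1) (hk' : k' ≤ n + 1)
    {M M' : SpecialLinearGroup (Fin 2) F[X]} (hM : WordProps k M) (hM' : WordProps k' M')
    (h0 : f ∣ M.1 0 0 - M'.1 0 0) (h1 : f ∣ M.1 1 0 - M'.1 1 0)
    (c0 : (M.1 0 0).coeff (n + 1) = (M'.1 0 0).coeff (n + 1))
    (c1 : (M.1 1 0).coeff (n + 1) = (M'.1 1 0).coeff (n + 1)) :
    M.1 0 0 = M'.1 0 0 ∧ M.1 1 0 = M'.1 1 0 := by
  have hd : ∀ i, (M.1 i 0 - M'.1 i 0).natDegree ≤ n + 1 := fun i =>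
    (natDegree_sub_le_of_le ((hM.degree_le i 0).trans hk) ((hM'.degree_le i 0).trans hk')).trans
      (max_self _).le
  constructor
  · rw [← sub_eq_zero, eq_mul_of_dvd hf hn hf0 h0 (hd 0)
      (by simp [hM.eval_zero₀₀, hM'.eval_zero₀₀]), coeff_sub, c0]
    simp
  · rw [← sub_eq_zero, eq_mul_of_dvd hf hn hf1 h1 (hd 1)
      (by simp [hM.eval_neg_one, hM'.eval_neg_one]), coeff_sub, c1]
    simp

variable [Fintype F]

lemma lead_det_eq_zero {k : ℕ} {M : SpecialLinearGroup (Fin 2) F[X]} (hM : M ∈ words F (k + 1)) :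
    (M.1 0 0).coeff (k + 1) * (M.1 1 1).coeff (k + 1) =
      (M.1 0 1).coeff (k + 1) * (M.1 1 0).coeff (k + 1) := by
  obtain ⟨N, hN, r, s, -, rfl⟩ := mem_words_succ.1 hM
  rw [(coeff_letter_mul r s (wordProps_of_mem hN) 0).2,
    (coeff_letter_mul r s (wordProps_of_mem hN) 1).2]
  ring

lemma eval_zero_ne_of_mem_words {k : ℕ} {M : SpecialLinearGroup (Fin 2) F[X]}
    (hM : M ∈ words F (k + 1)) : (M.1 1 0).eval 0 ≠ 0 := by
  obtain ⟨N, hN, r, s, h, rfl⟩ := mem_words_succ.1 hM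
  exact h.eval_zero_letter_mul_ne (wordProps_of_mem hN)

/-- Congruent words of lengths `n + 1` and `n` satisfy two relations between the leading
coefficients of the longer one. -/
lemma lead_relations (hf : f.Monic) (hn : f.natDegree = n) (hf0 : f.eval 0 ≠ 0)
    (hf1 : f.eval (-1) ≠ 0)
    {M M' : SpecialLinearGroup (Fin 2) F[X]} (hM : M ∈ words F (n + 1))
    (hM' : M' ∈ words F n) (hd : ∀ i j, f ∣ M.1 i j - M'.1 i j) :
    ((M'.1 0 0).eval (-1) - f.eval (-1) * (M.1 0 0).coeff (n + 1)) *
        ((M'.1 1 1).eval (-1) - f.eval (-1) * (M.1 1 1).coeff (n + 1)) = 1 ∧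
      ((M.1 0 0).coeff (n + 1) + (M.1 1 1).coeff (n + 1) -
          f.eval 0 * (M.1 0 0).coeff (n + 1) * (M.1 1 1).coeff (n + 1)) * (M.1 1 0).coeff (n + 1) -
        (derivative (M'.1 0 1)).eval 0 * (M.1 1 0).coeff (n + 1) ^ 2 -
        (M.1 0 0).coeff (n + 1) * (M.1 1 1).coeff (n + 1) * (M'.1 1 0).eval 0 = 0 := by
  have wM := wordProps_of_mem hM
  have wM' := wordProps_of_mem hM'
  have hdeg : ∀ i j, (M.1 i j - M'.1 i j).natDegree ≤ n + 1 := fun i j =>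
    (natDegree_sub_le_of_le (wM.degree_le i j)
      ((wM'.degree_le i j).trans (Nat.le_succ n))).trans (max_self _).le
  have hz : ∀ i j, (M.1 i j - M'.1 i j).coeff (n + 1) = (M.1 i j).coeff (n + 1) := fun i j => by
    rw [coeff_sub, coeff_eq_zero_of_natDegree_lt (Nat.lt_succ_of_le (wM'.degree_le i j)), sub_zero]
  have e00 := eq_mul_of_dvd hf hn hf0 (hd 0 0) (hdeg 0 0)
    (by simp [wM.eval_zero₀₀, wM'.eval_zero₀₀])
  have e01 := eq_mul_of_dvd hf hn hf0 (hd 0 1) (hdeg 0 1)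
    (by simp [wM.eval_zero₀₁, wM'.eval_zero₀₁])
  have e11 := eq_mul_of_dvd hf hn hf0 (hd 1 1) (hdeg 1 1)
    (by simp [wM.eval_zero₁₁, wM'.eval_zero₁₁])
  have e10 := eq_mul_of_dvd hf hn hf1 (hd 1 0) (hdeg 1 0)
    (by simp [wM.eval_neg_one, wM'.eval_neg_one])
  rw [hz, sub_eq_iff_eq_add] at e00 e01 e11 e10
  have hdet := wM.det_eval
  have hder := wM.derivative_eval
  have hder' := wM'.derivative_eval
  have hl := lead_det_eq_zero hM
  generalize (M.1 0 0).coeff (n + 1) = l at *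
  generalize (M.1 0 1).coeff (n + 1) = v at *
  generalize (M.1 1 0).coeff (n + 1) = m at *
  generalize (M.1 1 1).coeff (n + 1) = ρ at *
  rw [e00, e11] at hdet
  rw [e00, e11, e01, e10] at hder
  simp only [eval_add, eval_sub, eval_mul, eval_C, eval_X, derivative_add, derivative_sub,
    derivative_mul, derivative_C, derivative_X, eval_zero, eval_one] at hdet hder
  constructor
  · linear_combination hdet
  · refine mul_left_cancel₀ hf0 ?_
    linear_combination m * (hder - hder') - (f.eval 0 * (M'.1 1 0).eval 0 + f.eval 0 ^ 2 * m) * hl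

open Classical in
/-- At most `2 * |F|` words of length `n + 1` are congruent to a given word of length `n`. -/
lemma card_congruent_le (hf : f.Monic) (hn : f.natDegree = n) (hf0 : f.eval 0 ≠ 0)
    (hf1 : f.eval (-1) ≠ 0)
    (hn0 : n ≠ 0) {M' : SpecialLinearGroup (Fin 2) F[X]}
    (hM' : M' ∈ words F n) :
    ((words F (n + 1)).filter fun M => ∀ i j, f ∣ M.1 i j - M'.1 i j).card ≤
      2 * Fintype.card F := by
  have wM' := wordProps_of_mem hM'
  have hγ : (M'.1 1 0).eval 0 ≠ 0 := by
    obtain ⟨m, rfl⟩ := Nat.exists_eq_succ_of_ne_zero hn0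
    exact eval_zero_ne_of_mem_words hM'
  refine (Finset.card_le_mul_card_image (f := fun M => (M.1 0 0).coeff (n + 1)) _ 2 ?_).trans
    (Nat.mul_le_mul_left _ (Finset.card_le_univ _))
  -- For fixed `l` the relation at `-1` determines `ρ`, and the other relation makes `m` a root of
  -- `q`. The pair `(l, m)` then determines the word.
  intro l _
  set α := (M'.1 0 0).eval (-1) with hα
  set δ := (M'.1 1 1).eval (-1) with hδ
  set ρ := (δ - (α - f.eval (-1) * l)⁻¹) / f.eval (-1) with hρ
  set q : F[X] := C (-(derivative (M'.1 0 1)).eval 0) * X ^ 2 +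
    C (l + ρ - f.eval 0 * l * ρ) * X + C (-(l * ρ * (M'.1 1 0).eval 0)) with hq
  have hρM : ∀ M ∈ words F (n + 1), (∀ i j, f ∣ M.1 i j - M'.1 i j) →
      (M.1 0 0).coeff (n + 1) = l → (M.1 1 1).coeff (n + 1) = ρ := by
    rintro M hM hd rfl
    have h := (lead_relations hf hn hf0 hf1 hM hM' hd).1
    rw [hρ, inv_eq_of_mul_eq_one_right h]
    field_simp
    ring
  -- Since `l ≠ 0` for a word, this case means `ρ = 0`. The relation at `-1` compared with `α * δ =
  -- 1` then forces `l = 0`, so the fibre is empty.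
  by_cases hz : l * ρ = 0
  · refine (Finset.card_eq_zero.2 ?_).trans_le (Nat.zero_le 2)
    rw [Finset.eq_empty_iff_forall_notMem]
    intro M hM
    simp only [Finset.mem_filter] at hM
    obtain ⟨⟨hM, hd⟩, hl⟩ := hM
    have h := (lead_relations hf hn hf0 hf1 hM hM' hd).1
    have hl0 : l ≠ 0 := hl ▸ (wordProps_of_mem hM).lead
    rw [hρM M hM hd hl, hl, (mul_eq_zero.1 hz).resolve_left hl0] at h
    have hdet := wM'.det_eval
    have hδ0 : δ ≠ 0 := right_ne_zero_of_mul (hdet.trans_ne one_ne_zero)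
    exact mul_ne_zero (mul_ne_zero hf1 hl0) hδ0 (by linear_combination hdet - h)
  -- The constant coefficient of `q` is nonzero because the lower left entry of `M'` does not vanish
  -- at 0.
  · have hq0 : q ≠ 0 := by
      intro h
      have := congrArg (coeff · 0) h
      simp only [hq, coeff_add, coeff_C_mul, coeff_X_pow, coeff_X_zero, coeff_C_zero,
        coeff_zero] at this
      exact mul_ne_zero hz hγ (by simpa using this)
    refine le_trans ?_ ((Multiset.toFinset_card_le q.roots).trans ((card_roots' q).trans
      natDegree_quadratic_le))
    refine Finset.card_le_card_of_injOn (fun M => (M.1 1 0).coeff (n + 1)) ?_ ?_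
    · intro M hM
      simp only [Finset.coe_filter, Finset.mem_filter, Set.mem_ofPred_eq] at hM
      obtain ⟨⟨hM, hd⟩, hl⟩ := hM
      rw [Finset.mem_coe, Multiset.mem_toFinset, mem_roots hq0, IsRoot.def, hq]
      have h := (lead_relations hf hn hf0 hf1 hM hM' hd).2
      rw [hρM M hM hd hl, hl] at h
      simp only [eval_add, eval_mul, eval_C, eval_X, eval_pow]
      linear_combination h
    · intro M hM N hN e
      simp only [Finset.coe_filter, Finset.mem_filter, Set.mem_ofPred_eq] at hM hN
      obtain ⟨h0, h1⟩ := col_eq_of_dvd hf hn hf0 hf1 le_rfl le_rfl (wordProps_of_mem hM.1.1)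
        (wordProps_of_mem hN.1.1) (by simpa using dvd_sub (hM.1.2 0 0) (hN.1.2 0 0))
        (by simpa using dvd_sub (hM.1.2 1 0) (hN.1.2 1 0)) (hM.2.trans hN.2.symm) e
      exact words_col_injective hM.1.1 hN.1.1 h0 h1

end Quadratic
end SLTwo

namespace SLTwo

open Polynomial

/-! ### Specialisation to the algebra and a first unipotent element -/

section Generation

variable {p : ℕ} [Fact p.Prime]

/-- Otherwise the unit `x - c` could be cancelled, leaving an annihilating polynomial of smaller
degree. -/
lemma eval_minpoly_ne_zero {F A : Type*} [Field F] [CommRing A] [Nontrivial A] [Algebra F A]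
    {x : A} (hx : IsIntegral F x) (c : F) (hu : IsUnit (x - algebraMap F A c)) :
    (minpoly F x).eval c ≠ 0 := by
  intro h
  obtain ⟨g, hg⟩ := dvd_iff_isRoot.2 h
  have h1 := minpoly.aeval F x
  rw [hg, map_mul] at h1
  have h2 : aeval x g = 0 := by
    refine hu.mul_right_eq_zero.1 ?_
    simpa using h1
  have hne := minpoly.ne_zero hx
  have hg0 : g ≠ 0 := by rintro rfl; rw [mul_zero] at hg; exact hne hg
  have h3 := natDegree_le_of_dvd (minpoly.dvd F x h2) hg0
  rw [hg, natDegree_mul (X_sub_C_ne_zero c) hg0, natDegree_X_sub_C] at h3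
  omega

lemma finrank_eq_natDegree_minpoly {F A : Type*} [Field F] [CommRing A] [Algebra F A]
    {x : A} (hx : IsIntegral F x) (hgen : Algebra.adjoin F {x} = ⊤) :
    Module.finrank F A = (minpoly F x).natDegree := by
  rw [← (Subalgebra.topEquiv (R := F) (A := A)).toLinearEquiv.finrank_eq, ← hgen,
    (Algebra.adjoin.powerBasis hx).finrank, Algebra.adjoin.powerBasis_dim]

variable {A : Type*} [CommRing A] [Algebra (ZMod p) A]

lemma card_eq_pow_natDegree [Finite A] {x : A} (hgen : Algebra.adjoin (ZMod p) {x} = ⊤) :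
    Nat.card A = p ^ (minpoly (ZMod p) x).natDegree := by
  have : Module.Finite (ZMod p) A := Module.Finite.of_finite
  rw [← finrank_eq_natDegree_minpoly (IsIntegral.of_finite _ _) hgen,
    Module.natCard_eq_pow_finrank (K := ZMod p), Nat.card_zmod]

/-- Words over `F[X]` give elements of the group over `A`. -/
noncomputable def specialize (x : A) :
    SpecialLinearGroup (Fin 2) (ZMod p)[X] →* SpecialLinearGroup (Fin 2) A :=
  SpecialLinearGroup.map ((aeval x : (ZMod p)[X] →ₐ[ZMod p] A) : (ZMod p)[X] →+* A)

lemma specialize_mem {x : A} {k : ℕ} {M : SpecialLinearGroup (Fin 2) (ZMod p)[X]}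
    (hM : M ∈ words (ZMod p) k) : specialize x M ∈ pencilGroup (ZMod p) x := by
  have h := map_pencilGroup (F := ZMod p) (aeval x : (ZMod p)[X] →ₐ[ZMod p] A) X
  rw [aeval_X] at h
  rw [← h]
  exact ⟨M, mem_pencilGroup_of_mem_words hM, rfl⟩

variable [Finite A] [Nontrivial A] {x : A}

lemma col_eq_of_specialize (hx : IsUnit x) (hx1 : IsUnit (1 + x)) {k k' : ℕ}
    (hk : k ≤ (minpoly (ZMod p) x).natDegree + 1)
    (hk' : k' ≤ (minpoly (ZMod p) x).natDegree + 1)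
    {M M' : SpecialLinearGroup (Fin 2) (ZMod p)[X]} (hM : WordProps k M) (hM' : WordProps k' M')
    (h0 : (specialize x M).1 0 0 = (specialize x M').1 0 0)
    (h1 : (specialize x M).1 1 0 = (specialize x M').1 1 0)
    (c0 : (M.1 0 0).coeff ((minpoly (ZMod p) x).natDegree + 1) =
      (M'.1 0 0).coeff ((minpoly (ZMod p) x).natDegree + 1))
    (c1 : (M.1 1 0).coeff ((minpoly (ZMod p) x).natDegree + 1) =
      (M'.1 1 0).coeff ((minpoly (ZMod p) x).natDegree + 1)) :
    M.1 0 0 = M'.1 0 0 ∧ M.1 1 0 = M'.1 1 0 := by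
  have hint : IsIntegral (ZMod p) x := IsIntegral.of_finite _ _
  refine col_eq_of_dvd (minpoly.monic hint) rfl
    (eval_minpoly_ne_zero hint 0 (by simpa using hx))
    (eval_minpoly_ne_zero hint (-1) (by simpa [add_comm] using hx1)) hk hk' hM hM'
    (minpoly.dvd _ _ ?_) (minpoly.dvd _ _ ?_) c0 c1
  · rw [map_sub, sub_eq_zero]; exact h0
  · rw [map_sub, sub_eq_zero]; exact h1

lemma words_specialize_inj (hx : IsUnit x) (hx1 : IsUnit (1 + x))
    {M M' : SpecialLinearGroup (Fin 2) (ZMod p)[X]}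
    (hM : M ∈ words (ZMod p) (minpoly (ZMod p) x).natDegree)
    (hM' : M' ∈ words (ZMod p) (minpoly (ZMod p) x).natDegree)
    (h0 : (specialize x M).1 0 0 = (specialize x M').1 0 0)
    (h1 : (specialize x M).1 1 0 = (specialize x M').1 1 0) : M = M' := by
  have wM := wordProps_of_mem hM
  have wM' := wordProps_of_mem hM'
  have hz : ∀ {N : SpecialLinearGroup (Fin 2) (ZMod p)[X]},
      WordProps (minpoly (ZMod p) x).natDegree N →
      ∀ i, (N.1 i 0).coeff ((minpoly (ZMod p) x).natDegree + 1) = 0 := fun hN i =>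
    coeff_eq_zero_of_natDegree_lt (Nat.lt_succ_of_le (hN.degree_le i 0))
  obtain ⟨e0, e1⟩ := col_eq_of_specialize hx hx1 (Nat.le_succ _) (Nat.le_succ _) wM wM' h0 h1
    (by rw [hz wM, hz wM']) (by rw [hz wM, hz wM'])
  exact words_col_injective hM hM' e0 e1

/-- The orbit of the first basis vector has more than half as many elements as `A²`. -/
lemma exists_orbit_section (hx : IsUnit x) (hx1 : IsUnit (1 + x)) :
    ∃ W : Finset (SpecialLinearGroup (Fin 2) A), (∀ h ∈ W, h ∈ pencilGroup (ZMod p) x) ∧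
      (∀ g ∈ W, ∀ h ∈ W, g.1 0 0 = h.1 0 0 → g.1 1 0 = h.1 1 0 → g = h) ∧
      (p - 3) ^ (2 * (minpoly (ZMod p) x).natDegree) ≤ W.card := by
  classical
  refine ⟨(words (ZMod p) (minpoly (ZMod p) x).natDegree).image (specialize x), ?_, ?_, ?_⟩
  · intro h hh
    obtain ⟨M, hM, rfl⟩ := Finset.mem_image.1 hh
    exact specialize_mem hM
  · intro g hg h hh h0 h1
    obtain ⟨M, hM, rfl⟩ := Finset.mem_image.1 hg
    obtain ⟨M', hM', rfl⟩ := Finset.mem_image.1 hh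
    rw [words_specialize_inj hx hx1 hM hM' h0 h1]
  · rw [Finset.card_image_of_injOn]
    · simpa using card_words (F := ZMod p) (minpoly (ZMod p) x).natDegree
    · intro M hM M' hM' e
      exact words_specialize_inj hx hx1 hM hM' (by rw [e]) (by rw [e])

/-- The group contains a nontrivial upper unipotent element. -/
lemma exists_upper_mem (hx : IsUnit x) (hx1 : IsUnit (1 + x))
    (hgen : Algebra.adjoin (ZMod p) {x} = ⊤)
    (hp : 12 * (minpoly (ZMod p) x).natDegree + 8 < p) :
    ∃ y : A, y ≠ 0 ∧ upper y ∈ pencilGroup (ZMod p) x := by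
  classical
  cases nonempty_fintype A
  -- With no nontrivial upper unipotent, an element of the group is determined by its first column.
  -- Words of length `n + 1` are counted according to whether their column is that of a word of
  -- length `n`.
  by_contra! hno
  have hfree : ∀ g ∈ pencilGroup (ZMod p) x, ∀ h ∈ pencilGroup (ZMod p) x,
      g.1 0 0 = h.1 0 0 → g.1 1 0 = h.1 1 0 → g = h := by
    intro g hg h hh h0 h1
    obtain ⟨y, rfl⟩ := exists_eq_mul_upper h0 h1
    have hy : y = 0 := by
      by_contra hy
      exact hno y hy (((pencilGroup (ZMod p) x).mul_mem_cancel_left hg).1 hh)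
    rw [hy, upper_zero, mul_one]
  have hint : IsIntegral (ZMod p) x := IsIntegral.of_finite _ _
  have hcard := card_eq_pow_natDegree hgen
  have hn0 := (minpoly.natDegree_pos hint).ne'
  have hf := minpoly.monic hint
  have hf0 := eval_minpoly_ne_zero hint 0 (by simpa using hx)
  have hf1 := eval_minpoly_ne_zero hint (-1) (by simpa [add_comm] using hx1)
  obtain ⟨f, hfdef⟩ : ∃ f, f = minpoly (ZMod p) x := ⟨_, rfl⟩
  obtain ⟨n, hn⟩ : ∃ n, n = f.natDegree := ⟨_, rfl⟩
  have hinj : ∀ M ∈ words (ZMod p) n, ∀ M' ∈ words (ZMod p) n,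
      (specialize x M).1 0 0 = (specialize x M').1 0 0 →
      (specialize x M).1 1 0 = (specialize x M').1 1 0 → M = M' := by
    intro M hM M' hM' h0 h1
    rw [hn, hfdef] at hM hM'
    exact words_specialize_inj hx hx1 hM hM' h0 h1
  have hinj' : ∀ M ∈ words (ZMod p) (n + 1), ∀ M' ∈ words (ZMod p) (n + 1),
      (specialize x M).1 0 0 = (specialize x M').1 0 0 →
      (specialize x M).1 1 0 = (specialize x M').1 1 0 →
      (M.1 0 0).coeff (n + 1) = (M'.1 0 0).coeff (n + 1) →
      (M.1 1 0).coeff (n + 1) = (M'.1 1 0).coeff (n + 1) → M = M' := by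
    intro M hM M' hM' h0 h1 c0 c1
    rw [hn, hfdef] at hM hM' c0 c1
    obtain ⟨e0, e1⟩ := col_eq_of_specialize hx hx1 le_rfl le_rfl (wordProps_of_mem hM)
      (wordProps_of_mem hM') h0 h1 c0 c1
    exact words_col_injective hM hM' e0 e1
  rw [← hfdef] at hp hcard hn0 hf hf0 hf1
  rw [← hn] at hp hcard hn0
  rw [Nat.card_eq_fintype_card] at hcard
  set col : SpecialLinearGroup (Fin 2) (ZMod p)[X] → A × A := fun M =>
    ((specialize x M).1 0 0, (specialize x M).1 1 0) with hcol
  set I := (words (ZMod p) n).image col with hI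
  have hIcard : I.card = (words (ZMod p) n).card := by
    rw [hI, Finset.card_image_of_injOn]
    intro M hM M' hM' e
    exact hinj M hM M' hM' (congrArg Prod.fst e) (congrArg Prod.snd e)
  have hIle : I.card ≤ p ^ (2 * n) := by
    refine (Finset.card_le_univ _).trans ?_
    rw [Fintype.card_prod, hcard, ← pow_add, two_mul]
  have hcong : ∀ M ∈ words (ZMod p) (n + 1), ∀ M' ∈ words (ZMod p) n, col M' = col M →
      ∀ i j, f ∣ M.1 i j - M'.1 i j := by
    intro M hM M' hM' e i j
    have := hfree _ (specialize_mem (x := x) hM) _ (specialize_mem (x := x) hM')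
      (congrArg Prod.fst e).symm (congrArg Prod.snd e).symm
    rw [hfdef]
    refine minpoly.dvd _ _ ?_
    rw [map_sub, sub_eq_zero]
    exact congrArg (fun g => g.1 i j) this
  have hgood : ((words (ZMod p) (n + 1)).filter fun M => col M ∈ I).card ≤
      (words (ZMod p) n).card * (2 * p) := by
    refine (Finset.card_le_card (t := (words (ZMod p) n).biUnion fun M' =>
      (words (ZMod p) (n + 1)).filter fun M => ∀ i j, f ∣ M.1 i j - M'.1 i j) ?_).trans
      (Finset.card_biUnion_le_card_mul _ _ _ fun M' hM' => ?_)
    · intro M hM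
      obtain ⟨hM, hc⟩ := Finset.mem_filter.1 hM
      obtain ⟨M', hM', e⟩ := Finset.mem_image.1 hc
      exact Finset.mem_biUnion.2 ⟨M', hM', Finset.mem_filter.2 ⟨hM, hcong M hM M' hM' e⟩⟩
    · have := card_congruent_le hf hn.symm hf0 hf1 hn0 hM'
      rwa [ZMod.card] at this
  -- A word of length `n + 1` is determined by its reduced column together with its two leading
  -- coefficients, so each column outside `I` accounts for at most `p ^ 2` words.
  have hbad : ((words (ZMod p) (n + 1)).filter fun M => ¬ col M ∈ I).card ≤
      (p ^ (2 * n) - I.card) * p ^ 2 := by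
    have hc : (Iᶜ ×ˢ (Finset.univ : Finset (ZMod p × ZMod p))).card =
        (p ^ (2 * n) - I.card) * p ^ 2 := by
      rw [Finset.card_product, Finset.card_compl, Fintype.card_prod, hcard, ← pow_add, ← two_mul,
        Finset.card_univ, Fintype.card_prod, ZMod.card, sq]
    rw [← hc]
    refine Finset.card_le_card_of_injOn (fun M =>
      (col M, ((M.1 0 0).coeff (n + 1), (M.1 1 0).coeff (n + 1)))) ?_ ?_
    · intro M hM
      have := (Finset.mem_filter.1 hM).2
      simpa using this
    · intro M hM M' hM' e
      simp only [hcol, Prod.mk.injEq] at e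
      exact hinj' M (Finset.mem_filter.1 hM).1 M' (Finset.mem_filter.1 hM').1 e.1.1 e.1.2
        e.2.1 e.2.2
  have hsum := Finset.card_filter_add_card_filter_not (s := words (ZMod p) (n + 1))
    (fun M => col M ∈ I)
  have hw := card_words (F := ZMod p) n
  have hw' := card_words (F := ZMod p) (n + 1)
  rw [ZMod.card] at hw hw'
  have hlt := pow_count_lt hp
  rw [← hIcard] at hgood hw
  have hsub : (p ^ (2 * n) - I.card) * p ^ 2 + I.card * p ^ 2 = p ^ (2 * n) * p ^ 2 := by
    rw [← add_mul, Nat.sub_add_cancel hIle]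
  have h1 : (p - 3) ^ (2 * n) * p ^ 2 ≤ I.card * p ^ 2 := Nat.mul_le_mul_right _ hw
  have h2 : I.card * (2 * p) ≤ p ^ (2 * n) * (2 * p) := Nat.mul_le_mul_right _ hIle
  have h3 : p ^ (2 * n) * (2 * p) = 2 * p * p ^ (2 * n) := mul_comm _ _
  omega

end Generation
end SLTwo

namespace SLTwo

open Polynomial

/-! ### Generation of `SL₂` by induction on the dimension, and its order -/

section Generation

universe u

variable {p : ℕ} [Fact p.Prime]

/-- The entries of the upper unipotent elements of a group with large orbit form an ideal. -/
lemma smul_mem_upperEntries {A : Type*} [CommRing A] [Algebra (ZMod p) A] {x : A}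
    (hp2 : p ≠ 2) (hx : IsUnit x) (hx1 : IsUnit (1 + x))
    (hgen : Algebra.adjoin (ZMod p) {x} = ⊤) (H : Subgroup (SpecialLinearGroup (Fin 2) A))
    (hH : ∀ w, ∃ h ∈ H, ∃ y, ∃ h' ∈ H, ∃ y', h * upper y * w = h' * upper y') (a : A) {y : A}
    (hy : y ∈ upperEntries H) : a * y ∈ upperEntries H := by
  have hsm : ∀ (c : ZMod p) {y : A}, y ∈ upperEntries H →
      algebraMap (ZMod p) A c * y ∈ upperEntries H := by
    intro c y hy
    obtain ⟨m, rfl⟩ := ZMod.natCast_zmod_surjective c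
    rw [map_natCast, ← nsmul_eq_mul]
    exact AddSubgroup.nsmul_mem _ hy m
  -- Stability under squares of units suffices: `2xy = (1 + x)²y - x²y - y`, and 2 is invertible.
  have hxy : ∀ {y : A}, y ∈ upperEntries H → x * y ∈ upperEntries H := by
    intro y hy
    obtain ⟨u, hu⟩ := hx
    obtain ⟨v, hv⟩ := hx1
    have h1 := sq_mul_mem_upperEntries H hH u hy
    have h2 := sq_mul_mem_upperEntries H hH v hy
    rw [hu] at h1
    rw [hv] at h2
    have h3 := AddSubgroup.sub_mem _ (AddSubgroup.sub_mem _ h2 h1) hy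
    have h4 := hsm (2⁻¹ : ZMod p) h3
    have e : algebraMap (ZMod p) A 2⁻¹ * 2 = 1 := by
      have h2 : (2 : ZMod p) ≠ 0 := by
        intro h
        have : p ∣ 2 := (ZMod.natCast_eq_zero_iff 2 p).1 (by exact_mod_cast h)
        exact hp2 ((Nat.prime_dvd_prime_iff_eq Fact.out Nat.prime_two).1 this)
      rw [← map_ofNat (algebraMap (ZMod p) A) 2, ← map_mul, inv_mul_cancel₀ h2, map_one]
    convert h4 using 1
    linear_combination (-(x * y)) * e
  have ha : a ∈ Algebra.adjoin (ZMod p) {x} := hgen ▸ Algebra.mem_top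
  induction ha using Algebra.adjoin_induction generalizing y with
  | mem b hb => rw [Set.mem_singleton_iff.1 hb]; exact hxy hy
  | algebraMap c => exact hsm c hy
  | add b c _ _ hb hc => rw [add_mul]; exact AddSubgroup.add_mem _ (hb hy) (hc hy)
  | mul b c _ _ hb hc => rw [mul_assoc]; exact hb (hc hy)

/-- Let `A` be a finite von Neumann regular algebra over `ZMod p` generated by `x`, where `x` and
`1 + x` are units. If `p` is large compared to the dimension of `A`, then the elements
`pencil x s * (pencil x r)⁻¹` generate `SL₂(A)`. -/
theorem pencilGroup_eq_top {A : Type u} [CommRing A] [Algebra (ZMod p) A] [Finite A] {x : A}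
    (hreg : ∀ a : A, ∃ y, a * a * y = a) (hx : IsUnit x) (hx1 : IsUnit (1 + x))
    (hgen : Algebra.adjoin (ZMod p) {x} = ⊤) (hp : 12 * Module.finrank (ZMod p) A + 8 < p) :
    pencilGroup (ZMod p) x = ⊤ := by
  induction hn : Module.finrank (ZMod p) A using Nat.strong_induction_on generalizing A with
  | _ n ih =>
  rcases subsingleton_or_nontrivial A with hA | hA
  · have : Subsingleton (SpecialLinearGroup (Fin 2) A) :=
      ⟨fun g h => ext_of (Subsingleton.elim _ _) (Subsingleton.elim _ _)
        (Subsingleton.elim _ _) (Subsingleton.elim _ _)⟩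
    exact Subsingleton.elim _ _
  have hdeg := finrank_eq_natDegree_minpoly (IsIntegral.of_finite (ZMod p) x) hgen
  obtain ⟨W, hWH, hinj, hWcard⟩ := exists_orbit_section hx hx1 (p := p)
  have hH := exists_mem_and_mul_mem (pencilGroup (ZMod p) x) W hWH hinj (by
    rw [card_eq_pow_natDegree hgen, ← hdeg, ← pow_mul, mul_comm]
    rw [← hdeg] at hWcard
    exact (pow_lt_two_mul_pow hp).trans_le (Nat.mul_le_mul_left _ hWcard))
  obtain ⟨y, hy0, hy⟩ := exists_upper_mem hx hx1 hgen (hdeg ▸ hp)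
  let I : Ideal A :=
    { upperEntries (pencilGroup (ZMod p) x) with
      smul_mem' := fun a _ hy => smul_mem_upperEntries (by omega) hx hx1 hgen _ hH a hy }
  have hker := congruence_le hreg _ hH I fun y hy => hy
  have hyI : y ∈ I := hy
  have hfin : Module.finrank (ZMod p) (A ⧸ I) < Module.finrank (ZMod p) A := by
    have h1 := Submodule.finrank_quotient_add_finrank (I.restrictScalars (ZMod p))
    have h2 : 0 < Module.finrank (ZMod p) (I.restrictScalars (ZMod p)) := by
      have : Nontrivial (I.restrictScalars (ZMod p)) :=
        ⟨⟨⟨y, hyI⟩, 0, fun h => hy0 (congrArg Subtype.val h)⟩⟩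
      exact Module.finrank_pos
    have h3 : Module.finrank (ZMod p) (A ⧸ I.restrictScalars (ZMod p)) =
      Module.finrank (ZMod p) (A ⧸ I) := rfl
    omega
  let π : A →ₐ[ZMod p] A ⧸ I := Ideal.Quotient.mkₐ (ZMod p) I
  have hπ : Function.Surjective π := Ideal.Quotient.mkₐ_surjective _ _
  have : Finite (A ⧸ I) := Finite.of_surjective π hπ
  -- `I` is nonzero, so `A ⧸ I` has smaller dimension and inherits all hypotheses from `A`. The
  -- kernel of reduction already lies in the group.
  have htop := ih _ (hn ▸ hfin) (A := A ⧸ I) (x := π x) (by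
      intro a
      obtain ⟨a, rfl⟩ := hπ a
      obtain ⟨y, hy⟩ := hreg a
      exact ⟨π y, by rw [← map_mul, ← map_mul, hy]⟩) (hx.map π)
    (by simpa using hx1.map π)
    (by
      have := AlgHom.map_adjoin π {x}
      rw [hgen, Algebra.map_top, Set.image_singleton, (AlgHom.range_eq_top π).2 hπ] at this
      exact this.symm) (by omega) rfl
  rw [← map_pencilGroup π x] at htop
  rw [eq_top_iff]
  intro g _
  obtain ⟨h, hh, e⟩ : SpecialLinearGroup.map (π : A →+* A ⧸ I) g ∈
      (pencilGroup (ZMod p) x).map (SpecialLinearGroup.map (π : A →+* A ⧸ I)) :=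
    htop ▸ Subgroup.mem_top _
  have hk : h⁻¹ * g ∈ (SpecialLinearGroup.map (n := Fin 2) (π : A →+* A ⧸ I)).ker := by
    rw [MonoidHom.mem_ker, map_mul, map_inv, e, inv_mul_cancel]
  exact ((pencilGroup (ZMod p) x).mul_mem_cancel_left (Subgroup.inv_mem _ hh)).1 (hker hk)

/-- The elements `(pencil x r)⁻¹ * pencil x s` generate `SL₂(A)` too. -/
theorem closure_inv_mul_eq_top {F R : Type*} [Field F] [CommRing R] [Algebra F R] {x : R}
    (h : pencilGroup F x = ⊤) :
    Subgroup.closure {g | ∃ r s : Fˣ, g = (pencil x r)⁻¹ * pencil x s} = ⊤ := by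
  have hle : pencilGroup F x ≤ (Subgroup.closure {g | ∃ r s : Fˣ,
      g = (pencil x r)⁻¹ * pencil x s}).map (MulAut.conj (pencil x (1 : Fˣ))).toMonoidHom := by
    rw [pencilGroup, Subgroup.closure_le]
    rintro _ ⟨r, s, rfl⟩
    -- Conjugation by `pencil x 1` turns this product into `pencil x s * (pencil x r)⁻¹`.
    refine ⟨((pencil x 1)⁻¹ * pencil x s) * ((pencil x r)⁻¹ * pencil x 1),
      Subgroup.mul_mem _ (Subgroup.subset_closure ⟨1, s, rfl⟩)
        (Subgroup.subset_closure ⟨r, 1, rfl⟩), ?_⟩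
    simp only [MulEquiv.coe_toMonoidHom, MulAut.conj_apply, letter]
    group
  rw [h, top_le_iff] at hle
  rw [eq_top_iff]
  intro g _
  obtain ⟨k, hk, e⟩ : MulAut.conj (pencil x (1 : Fˣ)) g ∈ (Subgroup.closure {g | ∃ r s : Fˣ,
      g = (pencil x r)⁻¹ * pencil x s}).map (MulAut.conj (pencil x (1 : Fˣ))).toMonoidHom :=
    hle ▸ Subgroup.mem_top _
  rwa [← (MulAut.conj (pencil x (1 : Fˣ))).injective e]

/-- Bounds for the order of `SL₂(A)`. -/
lemma card_SL2_bounds {A : Type*} [CommRing A] [Algebra (ZMod p) A] [Finite A] [Nontrivial A]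
    {x : A} (hx : IsUnit x) (hx1 : IsUnit (1 + x))
    (hgen : Algebra.adjoin (ZMod p) {x} = ⊤) {n : ℕ} (hn : Module.finrank (ZMod p) A = n) :
    (p - 3) ^ (2 * n) * p ^ n ≤ Nat.card (SpecialLinearGroup (Fin 2) A) ∧
      Nat.card (SpecialLinearGroup (Fin 2) A) ≤ p ^ (3 * n) := by
  classical
  cases nonempty_fintype A
  have hdeg := finrank_eq_natDegree_minpoly (IsIntegral.of_finite (ZMod p) x) hgen
  have hcard := card_eq_pow_natDegree hgen
  obtain ⟨W, hWH, hinj, hWcard⟩ := exists_orbit_section hx hx1 (p := p)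
  rw [← hdeg, hn] at hcard hWcard
  constructor
  · have h := card_image_mul_upper W hinj
    have : Fintype (SpecialLinearGroup (Fin 2) A) := Fintype.ofFinite _
    rw [← Nat.card_eq_fintype_card, hcard] at h
    rw [Nat.card_eq_fintype_card]
    exact (Nat.mul_le_mul_right _ hWcard).trans (h ▸ Finset.card_le_univ _)
  · refine card_SL2_le.trans (le_of_eq ?_)
    rw [hcard]; ring

end Generation
end SLTwo

/-! ### Good reduction at almost all primes -/

namespace SplitQuadForm

open Polynomial

/-- The integer matrix `(det b)² Δ`. -/
def intDelta (Q : SplitQuadForm) : Matrix (Fin 4) (Fin 4) ℤ :=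
  (4 : ℤ) • (Q.b.adjugate * Q.a * Q.b.adjugateᵀ * Q.c) - (Q.b.det ^ 2) • 1

lemma det_bOver (Q : SplitQuadForm) (R : Type*) [CommRing R] :
    (Q.bOver R).det = (Q.b.det : R) := (Int.castRingHom R).map_det Q.b |>.symm

lemma inv_bOver (Q : SplitQuadForm) (F : Type*) [Field F] :
    (Q.bOver F)⁻¹ = ((Q.b.det : F)⁻¹) • Q.b.adjugate.map (Int.cast : ℤ → F) := by
  rw [Matrix.inv_def, det_bOver, Ring.inverse_eq_inv']
  congr 1
  exact ((Int.castRingHom F).map_adjugate Q.b).symm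

lemma intDelta_map (Q : SplitQuadForm) (F : Type*) [Field F] (hd : (Q.b.det : F) ≠ 0) :
    Q.intDelta.map (Int.cast : ℤ → F) = ((Q.b.det : F) ^ 2) • Q.Delta F := by
  have h1 : Q.intDelta.map (Int.cast : ℤ → F) =
      (4 : F) • (Q.b.adjugate.map (Int.cast : ℤ → F) * Q.aOver F *
        (Q.b.adjugate.map (Int.cast : ℤ → F))ᵀ * Q.cOver F) - ((Q.b.det : F) ^ 2) • 1 := by
    change (Int.castRingHom F).mapMatrix Q.intDelta = _
    rw [intDelta, map_sub, zsmul_eq_mul, zsmul_eq_mul, map_mul, map_mul, map_mul, map_mul, map_mul,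
      map_one, map_intCast, map_intCast, ← zsmul_eq_mul, ← zsmul_eq_mul]
    rw [← Int.cast_smul_eq_zsmul F, ← Int.cast_smul_eq_zsmul F]
    push_cast
    rfl
  rw [h1, Delta, inv_bOver, smul_sub]
  congr 1
  simp only [transpose_smul, Matrix.smul_mul, Matrix.mul_smul, smul_smul]
  congr 1
  field_simp

lemma hasEigenvalue_toLin'_iff {F : Type*} [Field F] (M : Matrix (Fin 4) (Fin 4) F) (μ : F) :
    Module.End.HasEigenvalue (toLin' M) μ ↔ ∃ v ≠ 0, M *ᵥ v = μ • v := by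
  constructor
  · intro h
    obtain ⟨v, hv⟩ := h.exists_hasEigenvector
    exact ⟨v, hv.2, by rw [← toLin'_apply]; exact hv.apply_eq_smul⟩
  · rintro ⟨v, hv, e⟩
    exact Module.End.hasEigenvalue_of_hasEigenvector
      (Module.End.hasEigenvector_iff.2 ⟨Module.End.mem_eigenspace_iff.2 e, hv⟩)

lemma separable_charpoly {F : Type*} [Field F] [IsAlgClosed F] (M : Matrix (Fin 4) (Fin 4) F)
    (h : {μ : F | Module.End.HasEigenvalue (toLin' M) μ}.ncard = 4) : M.charpoly.Separable := by
  classical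
  have hs : {μ : F | Module.End.HasEigenvalue (toLin' M) μ} = M.charpoly.roots.toFinset := by
    ext μ
    rw [Set.mem_ofPred_eq, Module.End.hasEigenvalue_iff_isRoot_charpoly, Matrix.charpoly_toLin',
      Finset.mem_coe, Multiset.mem_toFinset, mem_roots M.charpoly_monic.ne_zero]
  rw [hs, Set.ncard_coe_finset] at h
  have hsp := IsAlgClosed.splits M.charpoly
  rw [← nodup_roots_iff_of_splits M.charpoly_monic.ne_zero hsp,
    ← Multiset.toFinset_card_eq_card_iff_nodup, h, ← hsp.natDegree_eq_card_roots,
    charpoly_natDegree_eq_dim, Fintype.card_fin]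

/-- The reductions of a monic integer polynomial that is separable in characteristic zero are
separable for almost all primes. -/
lemma exists_separable_map {L : Type*} [Field L] [CharZero L] (f : ℤ[X]) (hf : f.Monic)
    (h : (f.map (Int.castRingHom L)).Separable) :
    ∃ m : ℤ, m ≠ 0 ∧ ∀ (F : Type) [Field F], (m : F) ≠ 0 →
      (f.map (Int.castRingHom F)).Separable := by
  by_cases h0 : f.natDegree = 0
  · refine ⟨1, one_ne_zero, fun F _ _ => ?_⟩
    rw [hf.natDegree_eq_zero.1 h0]
    simp
  -- The resultant is an integer combination of `f` and its derivative over `ℤ[X]`. This Bezout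
  -- identity survives reduction and shows separability wherever the resultant is nonzero.
  obtain ⟨r, hrdef⟩ : ∃ r, r = resultant f (derivative f) := ⟨_, rfl⟩
  refine ⟨r, ?_, ?_⟩
  · intro hr
    rw [hrdef] at hr
    have hinj : Function.Injective (Int.castRingHom L) := Int.cast_injective
    have h1 := resultant_ne_zero _ _ h
    rw [derivative_map, natDegree_map_eq_of_injective hinj, natDegree_map_eq_of_injective hinj,
      resultant_map_map, hr, map_zero] at h1
    exact h1 rfl
  · intro F _ hF
    obtain ⟨u, v, -, -, huv⟩ := exists_mul_add_mul_eq_C_resultant f (derivative f)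
      le_rfl le_rfl (Or.inl h0)
    have h2 := congrArg (Polynomial.map (Int.castRingHom F)) huv
    rw [← hrdef, map_C, Polynomial.map_add, Polynomial.map_mul, Polynomial.map_mul,
      ← derivative_map, eq_intCast] at h2
    refine ⟨C (r : F)⁻¹ * u.map (Int.castRingHom F),
      C (r : F)⁻¹ * v.map (Int.castRingHom F), ?_⟩
    rw [mul_assoc, mul_assoc, ← mul_add, mul_comm (u.map _), mul_comm (v.map _), h2, ← C_mul,
      inv_mul_cancel₀ hF, C_1]

/-- For a generic form, almost all primes satisfy the conditions used below. -/
lemma IsGeneric.exists_good {Q : SplitQuadForm} (hQ : Q.IsGeneric) :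
    ∃ N : ℤ, N ≠ 0 ∧ ∀ (F : Type) [Field F], (N : F) ≠ 0 →
      (2 : F) ≠ 0 ∧ (Q.a.det : F) ≠ 0 ∧ (Q.b.det : F) ≠ 0 ∧ (Q.Delta F).det ≠ 0 ∧
        (1 + Q.Delta F).det ≠ 0 ∧ (Q.intDelta.map (Int.cast : ℤ → F)).charpoly.Separable := by
  obtain ⟨hab, hcard, hev⟩ := hQ
  rw [det_mul] at hab
  have ha := left_ne_zero_of_mul hab
  have hb := right_ne_zero_of_mul hab
  set L := AlgebraicClosure ℚ
  have hbQ : (Q.b.det : ℚ) ≠ 0 := Int.cast_ne_zero.2 hb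
  have hbL : (Q.b.det : L) ≠ 0 := Int.cast_ne_zero.2 hb
  set D := (Q.Delta ℚ).map (algebraMap ℚ L) with hD
  have hEL : Q.intDelta.map (Int.cast : ℤ → L) = ((Q.b.det : L) ^ 2) • D := by
    have h := congrArg (fun M => M.map (algebraMap ℚ L)) (Q.intDelta_map ℚ hbQ)
    simp only [Matrix.map_map] at h
    have e : (algebraMap ℚ L : ℚ → L) ∘ (Int.cast : ℤ → ℚ) = (Int.cast : ℤ → L) := by
      ext z; simp
    rw [e] at h
    rw [h, hD]
    ext i j
    simp
  have hev0 : D.det ≠ 0 := by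
    intro h
    obtain ⟨v, hv, e⟩ := Matrix.exists_mulVec_eq_zero_iff.2 h
    exact (hev 0 ((hasEigenvalue_toLin'_iff _ _).2 ⟨v, hv, by rw [e, zero_smul]⟩)).1 rfl
  have hev1 : (1 + D).det ≠ 0 := by
    intro h
    obtain ⟨v, hv, e⟩ := Matrix.exists_mulVec_eq_zero_iff.2 h
    refine (hev (-1) ((hasEigenvalue_toLin'_iff _ _).2 ⟨v, hv, ?_⟩)).2 rfl
    rw [add_mulVec, one_mulVec] at e
    rw [neg_smul, one_smul]
    exact eq_neg_of_add_eq_zero_right e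
  have hsep : (Q.intDelta.map (Int.cast : ℤ → L)).charpoly.Separable := by
    refine separable_charpoly _ ?_
    rw [hEL]
    -- Clearing denominators multiplies the eigenvalues by `(det b)²`, so four distinct ones remain.
    have : {μ : L | Module.End.HasEigenvalue (toLin' ((Q.b.det : L) ^ 2 • D)) μ} =
        (fun μ => (Q.b.det : L) ^ 2 * μ) '' {μ : L | Module.End.HasEigenvalue (toLin' D) μ} := by
      have hd2 : (Q.b.det : L) ^ 2 ≠ 0 := pow_ne_zero 2 hbL
      ext μ
      simp only [Set.mem_ofPred_eq, Set.mem_image, hasEigenvalue_toLin'_iff, smul_mulVec]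
      constructor
      · rintro ⟨v, hv, e⟩
        refine ⟨((Q.b.det : L) ^ 2)⁻¹ * μ, ⟨v, hv, ?_⟩, mul_inv_cancel_left₀ hd2 μ⟩
        rw [mul_smul, ← e, inv_smul_smul₀ hd2]
      · rintro ⟨ν, ⟨v, hv, e⟩, rfl⟩
        exact ⟨v, hv, by rw [e, mul_smul]⟩
    rw [this, Set.ncard_image_of_injective _ (mul_right_injective₀ (pow_ne_zero 2 hbL)), hcard]
  have hmap : ∀ (F : Type) [Field F], (Q.intDelta.map (Int.cast : ℤ → F)).charpoly =
      Q.intDelta.charpoly.map (Int.castRingHom F) := fun F _ =>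
    charpoly_map Q.intDelta (Int.castRingHom F)
  rw [hmap L] at hsep
  obtain ⟨m, hm, hm'⟩ := exists_separable_map _ (charpoly_monic _) hsep
  have hdet : ∀ (F : Type) [Field F], (Q.intDelta.map (Int.cast : ℤ → F)).det =
      (Q.intDelta.det : F) := fun F _ => ((Int.castRingHom F).map_det Q.intDelta).symm
  have hdet1 : ∀ (F : Type) [Field F],
      (((Q.b.det : F) ^ 2) • 1 + Q.intDelta.map (Int.cast : ℤ → F)).det =
      ((((Q.b.det ^ 2) • (1 : Matrix (Fin 4) (Fin 4) ℤ) + Q.intDelta).det : ℤ) : F) := by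
    intro F _
    refine Eq.trans ?_ ((Int.castRingHom F).map_det
      ((Q.b.det ^ 2) • (1 : Matrix (Fin 4) (Fin 4) ℤ) + Q.intDelta)).symm
    refine congrArg (Matrix.det (n := Fin 4) (R := F)) ?_
    ext i j
    change (((Q.b.det : F) ^ 2) • (1 : Matrix (Fin 4) (Fin 4) F)) i j + (Q.intDelta i j : F) =
      (((Q.b.det ^ 2) • (1 : Matrix (Fin 4) (Fin 4) ℤ)) i j + Q.intDelta i j : ℤ)
    rw [Matrix.smul_apply, Matrix.smul_apply, Matrix.one_apply, Matrix.one_apply]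
    split_ifs <;> simp
  have h1 : Q.intDelta.det ≠ 0 := by
    intro h
    have := hdet L
    rw [h, hEL, det_smul, Int.cast_zero] at this
    exact mul_ne_zero (pow_ne_zero _ (pow_ne_zero 2 hbL)) hev0 this
  have h2 : ((Q.b.det ^ 2) • (1 : Matrix (Fin 4) (Fin 4) ℤ) + Q.intDelta).det ≠ 0 := by
    intro h
    have := hdet1 L
    rw [h, hEL, ← smul_add, det_smul, Int.cast_zero] at this
    exact mul_ne_zero (pow_ne_zero _ (pow_ne_zero 2 hbL)) hev1 this
  refine ⟨2 * Q.a.det * Q.b.det * Q.intDelta.det *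
    ((Q.b.det ^ 2) • (1 : Matrix (Fin 4) (Fin 4) ℤ) + Q.intDelta).det * m, ?_, ?_⟩
  · exact mul_ne_zero (mul_ne_zero (mul_ne_zero (mul_ne_zero (mul_ne_zero two_ne_zero ha) hb) h1)
      h2) hm
  · intro F _ hN
    simp only [Int.cast_mul, Int.cast_ofNat, ne_eq, mul_eq_zero, not_or] at hN
    obtain ⟨⟨⟨⟨⟨n2, na⟩, nb⟩, n1⟩, n1'⟩, nm⟩ := hN
    refine ⟨n2, na, nb, fun h => ?_, fun h => ?_, ?_⟩
    · have := hdet F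
      rw [intDelta_map Q F nb, det_smul, h, mul_zero] at this
      exact n1 this.symm
    · have := hdet1 F
      rw [intDelta_map Q F nb, ← smul_add, det_smul, h, mul_zero] at this
      exact n1' this.symm
    · rw [hmap]
      exact hm' F nm

end SplitQuadForm

/-! ### The algebra generated by a matrix with separable characteristic polynomial -/

namespace SplitQuadForm

open Polynomial SLTwo

/-- Over the algebraic closure there are four distinct eigenvalues, all roots of the minimal
polynomial, so its degree is at least 4. -/
lemma minpoly_eq_charpoly {K : Type*} [Field K] (M : Matrix (Fin 4) (Fin 4) K)
    (h : M.charpoly.Separable) : minpoly K M = M.charpoly := by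
  classical
  set L := AlgebraicClosure K
  set φ : Matrix (Fin 4) (Fin 4) K →ₐ[K] Matrix (Fin 4) (Fin 4) L := (Algebra.ofId K L).mapMatrix
  have hchar : (φ M).charpoly = M.charpoly.map (algebraMap K L) := charpoly_map M (algebraMap K L)
  have hsep : (φ M).charpoly.Separable := hchar ▸ h.map
  have hsp := IsAlgClosed.splits (φ M).charpoly
  have hcard : (φ M).charpoly.roots.toFinset.card = 4 := by
    rw [Multiset.toFinset_card_of_nodup (nodup_roots hsep), ← hsp.natDegree_eq_card_roots,
      charpoly_natDegree_eq_dim, Fintype.card_fin]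
  have hint : IsIntegral L (φ M) := IsIntegral.of_finite _ _
  have hintK : IsIntegral K M := IsIntegral.of_finite _ _
  have hroots : (φ M).charpoly.roots.toFinset ⊆ (minpoly L (φ M)).roots.toFinset := by
    intro μ hμ
    rw [Multiset.mem_toFinset, mem_roots (charpoly_monic _).ne_zero, ← charpoly_toLin',
      ← Module.End.hasEigenvalue_iff_isRoot_charpoly, Module.End.hasEigenvalue_iff_isRoot,
      minpoly_toLin'] at hμ
    rwa [Multiset.mem_toFinset, mem_roots (minpoly.ne_zero hint)]
  have hdvd : minpoly L (φ M) ∣ (minpoly K M).map (algebraMap K L) := by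
    refine minpoly.dvd _ _ ?_
    rw [aeval_map_algebraMap, aeval_algHom_apply, minpoly.aeval, map_zero]
  have hdeg : 4 ≤ (minpoly K M).natDegree := by
    have h1 := natDegree_le_of_dvd hdvd (Polynomial.map_ne_zero (minpoly.ne_zero hintK))
    rw [natDegree_map] at h1
    have h2 := (Finset.card_le_card hroots).trans
      ((Multiset.toFinset_card_le _).trans (card_roots' (minpoly L (φ M))))
    omega
  refine (eq_of_monic_of_dvd_of_natDegree_le (minpoly.monic hintK) (charpoly_monic M)
    (minpoly_dvd_charpoly M) ?_).symm
  rwa [charpoly_natDegree_eq_dim, Fintype.card_fin]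

/-- The class of `M` in the commutative algebra generated by `M`. -/
def adjoinGen {K : Type*} [Field K] (M : Matrix (Fin 4) (Fin 4) K) : Algebra.adjoin K {M} :=
  ⟨M, Algebra.subset_adjoin rfl⟩

lemma adjoin_adjoinGen {K : Type*} [Field K] (M : Matrix (Fin 4) (Fin 4) K) :
    Algebra.adjoin K {adjoinGen M} = ⊤ := by
  rw [eq_top_iff]
  rintro ⟨a, ha⟩ -
  have h := ha
  rw [Algebra.adjoin_singleton_eq_range_aeval] at h
  obtain ⟨P, hP⟩ := h
  have e : (⟨a, ha⟩ : Algebra.adjoin K {M}) = aeval (adjoinGen M) P := by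
    refine Subtype.ext ?_
    exact hP.symm.trans <| aeval_algHom_apply (Algebra.adjoin K {M}).val (adjoinGen M) P
  rw [e]
  exact aeval_mem_adjoin_singleton _ _

lemma finrank_adjoin {K : Type*} [Field K] (M : Matrix (Fin 4) (Fin 4) K)
    (h : M.charpoly.Separable) : Module.finrank K (Algebra.adjoin K {M}) = 4 := by
  have e : minpoly K (adjoinGen M) = minpoly K M :=
    (minpoly.algHom_eq (Algebra.adjoin K {M}).val Subtype.val_injective (adjoinGen M)).symm
  rw [finrank_eq_natDegree_minpoly (IsIntegral.of_finite K (adjoinGen M)) (adjoin_adjoinGen M),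
    e, minpoly_eq_charpoly M h, charpoly_natDegree_eq_dim, Fintype.card_fin]

/-- The minimal polynomial is squarefree, so it divides `P` as soon as it divides a power of `P`. -/
lemma eq_zero_of_isNilpotent_of_mem_adjoin {K : Type*} [Field K] (M : Matrix (Fin 4) (Fin 4) K)
    (h : M.charpoly.Separable) {a : Matrix (Fin 4) (Fin 4) K} (ha : a ∈ Algebra.adjoin K {M})
    (hn : IsNilpotent a) : a = 0 := by
  rw [Algebra.adjoin_singleton_eq_range_aeval] at ha
  obtain ⟨P, rfl⟩ := ha
  obtain ⟨k, hk⟩ := hn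
  have h1 : minpoly K M ∣ P ^ k := minpoly.dvd _ _ (by rw [map_pow]; exact hk)
  have hsq : Squarefree (minpoly K M) := by rw [minpoly_eq_charpoly M h]; exact h.squarefree
  obtain ⟨R, rfl⟩ := hsq.isRadical k P h1
  simp

lemma adjoin_smul {K : Type*} [Field K] (M : Matrix (Fin 4) (Fin 4) K) {c : K} (hc : c ≠ 0) :
    Algebra.adjoin K {c • M} = Algebra.adjoin K {M} := by
  refine le_antisymm (Algebra.adjoin_le ?_) (Algebra.adjoin_le ?_)
  · have hM : M ∈ Algebra.adjoin K {M} := Algebra.self_mem_adjoin_singleton K M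
    exact Set.singleton_subset_iff.2 ((Algebra.adjoin K {M}).smul_mem hM c)
  · have hM : c • M ∈ Algebra.adjoin K {c • M} := Algebra.self_mem_adjoin_singleton K _
    have h := (Algebra.adjoin K {c • M}).smul_mem hM c⁻¹
    rw [inv_smul_smul₀ hc] at h
    exact Set.singleton_subset_iff.2 h

/-- Such a ring is a product of fields, where the componentwise inverse works with the convention
`0⁻¹ = 0`. -/
lemma exists_sq_mul_eq {A : Type*} [CommRing A] [Finite A] [IsReduced A] (a : A) :
    ∃ y, a * a * y = a := by
  have e := IsArtinianRing.equivPi A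
  let _ : ∀ m : MaximalSpectrum A, Field (A ⧸ m.asIdeal) := fun m => Ideal.Quotient.field _
  refine ⟨e.symm fun m => (e a m)⁻¹, e.injective ?_⟩
  rw [map_mul, map_mul, AlgEquiv.apply_symm_apply]
  funext m
  exact mul_self_mul_inv (e a m)

/-- `SL₂` of a finite product of rings. -/
noncomputable def SL2PiEquiv {A ι : Type*} [CommRing A] {R : ι → Type*} [∀ i, CommRing (R i)]
    (e : A ≃+* ∀ i, R i) :
    SpecialLinearGroup (Fin 2) A ≃* ∀ i, SpecialLinearGroup (Fin 2) (R i) :=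
  MulEquiv.ofBijective (MonoidHom.pi fun i => SpecialLinearGroup.map (n := Fin 2)
    ((Pi.evalRingHom R i).comp (e : A →+* ∀ i, R i))) (by
    constructor
    · intro g h hgh
      have key : ∀ a b, g.1 a b = h.1 a b := fun a b => e.injective (funext fun i =>
        congrArg (fun k => (k i).1 a b) hgh)
      exact ext_of (key _ _) (key _ _) (key _ _) (key _ _)
    · intro f
      refine ⟨⟨Matrix.of fun a b => e.symm fun i => (f i).1 a b, ?_⟩, ?_⟩
      · apply e.injective
        rw [det_fin_two]
        simp only [of_apply, map_sub, map_mul, RingEquiv.apply_symm_apply, map_one]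
        funext i
        exact det_eq (f i)
      · funext i
        have key : ∀ a b, (e (e.symm fun i => (f i).1 a b)) i = (f i).1 a b := fun a b => by
          rw [RingEquiv.apply_symm_apply]
        exact ext_of (key _ _) (key _ _) (key _ _) (key _ _))

/-- `SL₂` of a finite reduced algebra over `ZMod p` is a product of groups `SL₂` over finite
fields. -/
lemma exists_SL2_equiv_pi {p : ℕ} [Fact p.Prime] (A : Type*) [CommRing A] [Algebra (ZMod p) A]
    [Finite A] [IsReduced A] :
    ∃ (k : ℕ) (n : Fin k → ℕ), (∀ i, 0 < n i) ∧ ∑ i, n i = Module.finrank (ZMod p) A ∧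
      Nonempty (SpecialLinearGroup (Fin 2) A ≃*
        ∀ i, SpecialLinearGroup (Fin 2) (GaloisField p (n i))) := by
  obtain ⟨k, ⟨σ⟩⟩ := Finite.exists_equiv_fin (MaximalSpectrum A)
  let _ : ∀ m : MaximalSpectrum A, Field (A ⧸ m.asIdeal) := fun m => Ideal.Quotient.field _
  have hfin : ∀ m : MaximalSpectrum A, Finite (A ⧸ m.asIdeal) := fun m =>
    Finite.of_surjective _ Ideal.Quotient.mk_surjective
  let n : Fin k → ℕ := fun i => Module.finrank (ZMod p) (A ⧸ (σ.symm i).asIdeal)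
  have hcard : ∀ i, Nat.card (A ⧸ (σ.symm i).asIdeal) = p ^ n i := fun i => by
    rw [Module.natCard_eq_pow_finrank (K := ZMod p), Nat.card_zmod]
  let e : A ≃+* ∀ i, GaloisField p (n i) :=
    ((IsArtinianRing.equivPi A).toRingEquiv.trans
      (RingEquiv.piCongrLeft' (fun m : MaximalSpectrum A => A ⧸ m.asIdeal) σ)).trans
      (RingEquiv.piCongrRight fun i =>
        (GaloisField.algEquivGaloisField p (n i) (hcard i)).toRingEquiv)
  refine ⟨k, n, fun i => Module.finrank_pos, ?_, ⟨SL2PiEquiv e⟩⟩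
  -- The sum of the degrees is read off from cardinalities.
  have h1 := Nat.card_congr e.toEquiv
  rw [Nat.card_pi, Module.natCard_eq_pow_finrank (K := ZMod p), Nat.card_zmod] at h1
  have h2 : ∀ i, Nat.card (GaloisField p (n i)) = p ^ n i := fun i =>
    (Nat.card_congr (GaloisField.algEquivGaloisField p (n i) (hcard i)).toEquiv).symm.trans
      (hcard i)
  simp only [h2, Finset.prod_pow_eq_pow_sum] at h1
  exact (Nat.pow_right_injective (Fact.out : p.Prime).two_le h1).symm

/-- Invertibility as a matrix makes `a` a non-zero-divisor, and in an Artinian ring these are units.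
-/
lemma isUnit_adjoin_of_det_ne_zero {K : Type*} [Field K] [Finite K]
    {M : Matrix (Fin 4) (Fin 4) K} (a : Algebra.adjoin K {M})
    (h : (a : Matrix (Fin 4) (Fin 4) K).det ≠ 0) : IsUnit a := by
  refine IsArtinianRing.isUnit_of_mem_nonZeroDivisors (mem_nonZeroDivisors_iff_right.2 ?_)
  intro z hz
  have h1 : (z : Matrix (Fin 4) (Fin 4) K) * a = 0 := congrArg Subtype.val hz
  refine Subtype.ext ?_
  have := congrArg (· * (a : Matrix (Fin 4) (Fin 4) K)⁻¹) h1
  simpa [Matrix.mul_assoc, Matrix.mul_nonsing_inv _ (isUnit_iff_ne_zero.2 h)] using this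

end SplitQuadForm

/-! ### Conjugating the symplectic group to `SL₂(F_p[Δ])` -/

namespace SplitQuadForm

open Polynomial SLTwo

/-- The dilates of the symplectic element factor through the pencil, up to constant factors. -/
lemma dilate_eq_mul (Q : SplitQuadForm) {K : Type*} [Field K] (hb : IsUnit (Q.bOver K).det)
    (hB : IsUnit (Q.B K).det) (r : Kˣ) :
    ((Q.symplecticElement K hb).dilate r).1 =
      fromBlocks 0 ((Q.bOver K)⁻¹ᵀ * (Q.B K)⁻¹) (-Q.bOver K) 0 *
        ((SL2AdjoinToGL8 (Q.Delta K) (pencil (adjoinGen (Q.Delta K)) r) : GL8 K) :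
          Matrix (Fin 4 ⊕ Fin 4) (Fin 4 ⊕ Fin 4) K) * fromBlocks 1 0 0 (Q.B K) := by
  have hφ : ((SL2AdjoinToGL8 (Q.Delta K) (pencil (adjoinGen (Q.Delta K)) r) : GL8 K) :
      Matrix (Fin 4 ⊕ Fin 4) (Fin 4 ⊕ Fin 4) K) =
      fromBlocks (-((r : K) • Q.Delta K)) (-1) (1 + Q.Delta K) (((r⁻¹ : Kˣ) : K) • 1) := by
    change fromBlocks _ _ _ _ = _
    congr 1
    · change -(algebraMap K (Matrix (Fin 4) (Fin 4) K) r * Q.Delta K) = _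
      rw [← Algebra.smul_def]
    · change algebraMap K (Matrix (Fin 4) (Fin 4) K) _ = _
      rw [Algebra.algebraMap_eq_smul_one]
  have h1 : (Q.B K)⁻¹ * Q.B K = 1 := nonsing_inv_mul _ hB
  have h2 : Q.bOver K * (Q.bOver K)⁻¹ = 1 := mul_nonsing_inv _ hb
  have hΔ : 1 + Q.Delta K = -((2 : K) • (Q.B K * Q.cOver K)) := by
    rw [Delta, B]
    simp only [Matrix.neg_mul, Matrix.smul_mul, smul_neg, neg_neg, smul_smul, add_sub_cancel]
    norm_num
  have hbΔ : Q.bOver K * Q.Delta K =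
      (4 : K) • (Q.aOver K * (Q.bOver K)⁻¹ᵀ * Q.cOver K) - Q.bOver K := by
    rw [Delta, Matrix.mul_sub, Matrix.mul_smul, Matrix.mul_one, ← Matrix.mul_assoc,
      ← Matrix.mul_assoc, ← Matrix.mul_assoc, h2, Matrix.one_mul]
  have hbB : Q.bOver K * Q.B K = -((2 : K) • (Q.aOver K * (Q.bOver K)⁻¹ᵀ)) := by
    rw [B, Matrix.mul_neg, Matrix.mul_smul, ← Matrix.mul_assoc, ← Matrix.mul_assoc, h2,
      Matrix.one_mul]
  rw [hφ, fromBlocks_multiply, fromBlocks_multiply]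
  change fromBlocks _ _ _ _ = _
  congr 1
  · simp only [Matrix.zero_mul, zero_add, Matrix.mul_one, Matrix.mul_zero, add_zero]
    rw [hΔ, Matrix.mul_neg, Matrix.mul_smul, Matrix.mul_assoc, ← Matrix.mul_assoc (Q.B K)⁻¹, h1,
      Matrix.one_mul]
    rfl
  · simp only [Matrix.zero_mul, zero_add, Matrix.mul_zero, Matrix.mul_smul, Matrix.mul_one,
      Matrix.smul_mul, Matrix.mul_assoc, h1]
    rfl
  · simp only [Matrix.zero_mul, add_zero, Matrix.mul_one, Matrix.mul_zero, Matrix.mul_neg,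
      Matrix.neg_mul, Matrix.mul_smul, hbΔ, smul_neg, neg_neg]
    rfl
  · simp only [Matrix.zero_mul, add_zero, Matrix.mul_one, Matrix.mul_zero, Matrix.mul_neg,
      Matrix.neg_mul, neg_neg, zero_add, hbB]
    rfl

lemma toGL8_injective (R : Type*) [CommRing R] : Function.Injective (Sp8.toGL8 R) := fun _ _ e =>
  Subtype.ext (congrArg Units.val e)

lemma SL2AdjoinToGL8_injective {R : Type*} [CommRing R] (D : Matrix (Fin 4) (Fin 4) R) :
    Function.Injective (SL2AdjoinToGL8 D) := by
  intro g h e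
  have e1 : fromBlocks (g.1 0 0 : Matrix (Fin 4) (Fin 4) R) (g.1 0 1 : Matrix (Fin 4) (Fin 4) R)
      (g.1 1 0 : Matrix (Fin 4) (Fin 4) R) (g.1 1 1 : Matrix (Fin 4) (Fin 4) R) =
      fromBlocks (h.1 0 0 : Matrix (Fin 4) (Fin 4) R) (h.1 0 1 : Matrix (Fin 4) (Fin 4) R)
      (h.1 1 0 : Matrix (Fin 4) (Fin 4) R) (h.1 1 1 : Matrix (Fin 4) (Fin 4) R) :=
    congrArg Units.val e
  obtain ⟨h1, h2, h3, h4⟩ := fromBlocks_inj.1 e1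
  exact ext_of (Subtype.ext h1) (Subtype.ext h2) (Subtype.ext h3) (Subtype.ext h4)

/-- The left factor in `dilate_eq_mul` does not depend on the dilation parameter, so it cancels in
the quotient. -/
lemma toGL8_generator (Q : SplitQuadForm) {K : Type*} [Field K] (hb : IsUnit (Q.bOver K).det)
    (hB : IsUnit (Q.B K).det) (τ : GL8 K)
    (hτ : (τ : Matrix (Fin 4 ⊕ Fin 4) (Fin 4 ⊕ Fin 4) K) = fromBlocks 1 0 0 (Q.B K)) (r s : Kˣ) :
    Sp8.toGL8 K (((Q.symplecticElement K hb).dilate r)⁻¹ * (Q.symplecticElement K hb).dilate s) =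
      τ⁻¹ * SL2AdjoinToGL8 (Q.Delta K) ((pencil (adjoinGen (Q.Delta K)) r)⁻¹ *
        pencil (adjoinGen (Q.Delta K)) s) * τ := by
  set φ := SL2AdjoinToGL8 (Q.Delta K)
  set h := pencil (F := K) (adjoinGen (Q.Delta K))
  set u : Kˣ → GL8 K := fun r => Sp8.toGL8 K ((Q.symplecticElement K hb).dilate r) with hu
  have hC : ∀ r, (u r : Matrix (Fin 4 ⊕ Fin 4) (Fin 4 ⊕ Fin 4) K) =
      fromBlocks 0 ((Q.bOver K)⁻¹ᵀ * (Q.B K)⁻¹) (-Q.bOver K) 0 *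
        ((φ (h r) * τ : GL8 K) : Matrix (Fin 4 ⊕ Fin 4) (Fin 4 ⊕ Fin 4) K) := fun r => by
    rw [Units.val_mul, ← Matrix.mul_assoc, hτ]
    exact Q.dilate_eq_mul hb hB r
  have hconst : ∀ r s, u r * (φ (h r) * τ)⁻¹ = u s * (φ (h s) * τ)⁻¹ := by
    have : ∀ r, ((u r * (φ (h r) * τ)⁻¹ : GL8 K) :
        Matrix (Fin 4 ⊕ Fin 4) (Fin 4 ⊕ Fin 4) K) =
        fromBlocks 0 ((Q.bOver K)⁻¹ᵀ * (Q.B K)⁻¹) (-Q.bOver K) 0 := fun r => by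
      rw [Units.val_mul, hC r, Matrix.mul_assoc, Units.mul_inv, Matrix.mul_one]
    exact fun r s => Units.ext ((this r).trans (this s).symm)
  have hrs := hconst r s
  rw [map_mul, map_inv, map_mul φ, map_inv φ]
  change (u r)⁻¹ * u s = _
  have e : u s = u r * (φ (h r) * τ)⁻¹ * (φ (h s) * τ) := by
    rw [hrs, inv_mul_cancel_right]
  rw [e]
  group

/-- The description of `Γ` over a prime field of large characteristic with good reduction. -/
theorem map_Gam_eq (Q : SplitQuadForm) {p : ℕ} [Fact p.Prime] (hp : 56 < p)
    (hb : IsUnit (Q.bOver (ZMod p)).det) (hB : IsUnit (Q.B (ZMod p)).det)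
    (hΔ : (Q.Delta (ZMod p)).det ≠ 0) (hΔ1 : (1 + Q.Delta (ZMod p)).det ≠ 0)
    [IsReduced (Algebra.adjoin (ZMod p) {Q.Delta (ZMod p)})]
    (hrank : Module.finrank (ZMod p) (Algebra.adjoin (ZMod p) {Q.Delta (ZMod p)}) = 4)
    (τ : GL8 (ZMod p)) (hτ : (τ : Matrix (Fin 4 ⊕ Fin 4) (Fin 4 ⊕ Fin 4) (ZMod p)) =
      fromBlocks 1 0 0 (Q.B (ZMod p))) :
    (Q.Gam (ZMod p) hb).map (Sp8.toGL8 (ZMod p)) =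
      (SL2AdjoinToGL8 (Q.Delta (ZMod p))).range.map (MulAut.conj τ⁻¹).toMonoidHom := by
  -- The bound `56 = 12 * 4 + 8` is the threshold of `pencilGroup_eq_top` in dimension 4.
  have hgen := closure_inv_mul_eq_top (pencilGroup_eq_top (p := p)
    (x := adjoinGen (Q.Delta (ZMod p))) exists_sq_mul_eq (isUnit_adjoin_of_det_ne_zero _ hΔ)
    (isUnit_adjoin_of_det_ne_zero _ hΔ1) (adjoin_adjoinGen _) (by rw [hrank]; exact hp))
  rw [MonoidHom.range_eq_map, ← hgen, Gam, MonoidHom.map_closure, MonoidHom.map_closure,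
    MonoidHom.map_closure]
  congr 1
  ext g
  simp only [Set.mem_image, Set.mem_ofPred_eq]
  constructor
  · rintro ⟨_, ⟨r, s, rfl⟩, rfl⟩
    refine ⟨_, ⟨_, ⟨r, s, rfl⟩, rfl⟩, ?_⟩
    rw [Q.toGL8_generator hb hB τ hτ]
    simp
  · rintro ⟨_, ⟨_, ⟨r, s, rfl⟩, rfl⟩, rfl⟩
    refine ⟨_, ⟨r, s, rfl⟩, ?_⟩
    rw [Q.toGL8_generator hb hB τ hτ]
    simp

/-- For a generic form and all large primes, `Γ` is conjugate to `SL₂(F_p[Δ])`, where `F_p[Δ]` is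
reduced of dimension `4`. -/
theorem IsGeneric.eventually {Q : SplitQuadForm} (hQ : Q.IsGeneric) :
    ∃ p₀ : ℕ, 57 ≤ p₀ ∧ ∀ (p : ℕ) [Fact p.Prime], p₀ ≤ p →
      ∃ (hb : IsUnit (Q.bOver (ZMod p)).det) (τ : GL8 (ZMod p)),
        (τ : Matrix (Fin 4 ⊕ Fin 4) (Fin 4 ⊕ Fin 4) (ZMod p)) = fromBlocks 1 0 0 (Q.B (ZMod p)) ∧
        (Q.Gam (ZMod p) hb).map (Sp8.toGL8 (ZMod p)) =
          (SL2AdjoinToGL8 (Q.Delta (ZMod p))).range.map (MulAut.conj τ⁻¹).toMonoidHom ∧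
        Nonempty (Q.Gam (ZMod p) hb ≃* SpecialLinearGroup (Fin 2)
          (Algebra.adjoin (ZMod p) {Q.Delta (ZMod p)})) ∧
        IsReduced (Algebra.adjoin (ZMod p) {Q.Delta (ZMod p)}) ∧
        Module.finrank (ZMod p) (Algebra.adjoin (ZMod p) {Q.Delta (ZMod p)}) = 4 ∧
        (Q.Delta (ZMod p)).det ≠ 0 ∧ (1 + Q.Delta (ZMod p)).det ≠ 0 := by
  obtain ⟨N, hN, hgood⟩ := hQ.exists_good
  refine ⟨N.natAbs + 57, Nat.le_add_left _ _, fun p _ hp => ?_⟩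
  have hNp : (N : ZMod p) ≠ 0 := by
    intro h
    rw [ZMod.intCast_zmod_eq_zero_iff_dvd, Int.natCast_dvd] at h
    have := Nat.le_of_dvd (Int.natAbs_pos.2 hN) h
    omega
  obtain ⟨h2, ha, hbd, hΔ, hΔ1, hsep⟩ := hgood (ZMod p) hNp
  have hb : IsUnit (Q.bOver (ZMod p)).det := by
    rw [det_bOver]; exact isUnit_iff_ne_zero.2 hbd
  have hB : IsUnit (Q.B (ZMod p)).det := by
    have had : (Q.aOver (ZMod p)).det = (Q.a.det : ZMod p) :=
      ((Int.castRingHom (ZMod p)).map_det Q.a).symm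
    have hinv : (Q.bOver (ZMod p))⁻¹.det ≠ 0 := (isUnit_nonsing_inv_det _ hb).ne_zero
    rw [B, ← neg_smul, det_smul, det_mul, det_mul, det_transpose, had]
    exact isUnit_iff_ne_zero.2 (mul_ne_zero (pow_ne_zero _ (neg_ne_zero.2 h2))
      (mul_ne_zero (mul_ne_zero hinv ha) hinv))
  have hadj : Algebra.adjoin (ZMod p) {Q.intDelta.map (Int.cast : ℤ → ZMod p)} =
      Algebra.adjoin (ZMod p) {Q.Delta (ZMod p)} := by
    rw [intDelta_map Q _ hbd]
    exact adjoin_smul _ (pow_ne_zero 2 hbd)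
  have hrank := finrank_adjoin _ hsep
  rw [hadj] at hrank
  have hred : IsReduced (Algebra.adjoin (ZMod p) {Q.Delta (ZMod p)}) :=
    ⟨fun a ha => Subtype.ext (eq_zero_of_isNilpotent_of_mem_adjoin _ hsep (by rw [hadj]; exact a.2)
      (ha.map (Algebra.adjoin (ZMod p) {Q.Delta (ZMod p)}).val))⟩
  have hτdet : (fromBlocks 1 0 0 (Q.B (ZMod p)) :
      Matrix (Fin 4 ⊕ Fin 4) (Fin 4 ⊕ Fin 4) (ZMod p)).det ≠ 0 := by
    rw [det_fromBlocks_zero₂₁, det_one, one_mul]; exact hB.ne_zero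
  let τ : GL8 (ZMod p) := GeneralLinearGroup.mkOfDetNeZero _ hτdet
  have hmap := Q.map_Gam_eq (by omega) hb hB hΔ hΔ1 hrank τ rfl
  refine ⟨hb, τ, rfl, hmap, ⟨?_⟩, hred, hrank, hΔ, hΔ1⟩
  exact ((Q.Gam (ZMod p) hb).equivMapOfInjective _ (toGL8_injective _)).trans
    ((MulEquiv.subgroupCongr hmap).trans
      (((SL2AdjoinToGL8 (Q.Delta (ZMod p))).range.equivMapOfInjective _
        (MulAut.conj τ⁻¹).injective).symm.trans
        (MonoidHom.ofInjective (SL2AdjoinToGL8_injective _)).symm))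

end SplitQuadForm

theorem proposition10p1 (Q : SplitQuadForm) (hQ : Q.IsGeneric) :
    (∃ p₀ : ℕ, ∀ (p : ℕ) [Fact p.Prime], p₀ ≤ p →
      ∃ (hb : IsUnit (Q.bOver (ZMod p)).det) (τ : GL8 (ZMod p)),
        (τ : Matrix (Fin 4 ⊕ Fin 4) (Fin 4 ⊕ Fin 4) (ZMod p)) =
            Matrix.fromBlocks 1 0 0 (Q.B (ZMod p)) ∧
        (Q.Gam (ZMod p) hb).map (Sp8.toGL8 (ZMod p)) =
            (SL2AdjoinToGL8 (Q.Delta (ZMod p))).range.map (MulAut.conj τ⁻¹).toMonoidHom ∧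
        ∃ (k : ℕ) (n : Fin k → ℕ), (∀ i, 0 < n i) ∧ ∑ i, n i = 4 ∧
          Nonempty (Q.Gam (ZMod p) hb ≃*
            ∀ i, Matrix.SpecialLinearGroup (Fin 2) (GaloisField p (n i)))) ∧
    (∀ ε : ℝ, 0 < ε → ∃ p₁ : ℕ, ∀ (p : ℕ) [Fact p.Prime], p₁ ≤ p →
      ∃ hb : IsUnit (Q.bOver (ZMod p)).det,
        |(Nat.card (Q.Gam (ZMod p) hb) : ℝ) / (p : ℝ) ^ 12 - 1| ≤ ε) := by
  obtain ⟨p₀, h57, h⟩ := hQ.eventually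
  -- The order lies between `(p - 3)^8 * p^4` and `p^12`, and `(1 - 3/p)^8 ≥ 1 - 24/p`; hence `p ≥
  -- 24 / ε` suffices.
  refine ⟨⟨p₀, fun p _ hp => ?_⟩, fun ε hε => ⟨p₀ + ⌈24 / ε⌉₊, fun p _ hp => ?_⟩⟩
  · obtain ⟨hb, τ, hτ, hmap, ⟨e⟩, hred, hrank, -, -⟩ := h p hp
    obtain ⟨k, n, hn, hsum, ⟨e'⟩⟩ :=
      SplitQuadForm.exists_SL2_equiv_pi (p := p) (Algebra.adjoin (ZMod p) {Q.Delta (ZMod p)})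
    exact ⟨hb, τ, hτ, hmap, k, n, hn, hsum.trans hrank, ⟨e.trans e'⟩⟩
  · obtain ⟨hb, τ, hτ, hmap, ⟨e⟩, hred, hrank, hΔ, hΔ1⟩ := h p (by omega)
    refine ⟨hb, ?_⟩
    rw [Nat.card_congr e.toEquiv]
    have hnt : Nontrivial (Algebra.adjoin (ZMod p) {Q.Delta (ZMod p)}) :=
      Module.nontrivial_of_finrank_pos (R := ZMod p) (by rw [hrank]; norm_num)
    obtain ⟨hlo, hhi⟩ := SLTwo.card_SL2_bounds (p := p)
      (x := SplitQuadForm.adjoinGen (Q.Delta (ZMod p)))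
      (SplitQuadForm.isUnit_adjoin_of_det_ne_zero _ hΔ)
      (SplitQuadForm.isUnit_adjoin_of_det_ne_zero _ hΔ1)
      (SplitQuadForm.adjoin_adjoinGen _) hrank
    generalize Nat.card (SpecialLinearGroup (Fin 2)
      (Algebra.adjoin (ZMod p) {Q.Delta (ZMod p)})) = c at *
    have h3 : 3 ≤ p := by omega
    have hq : (3 : ℝ) ≤ p := by exact_mod_cast h3
    have hp0 : (0 : ℝ) < p := by linarith
    have hlo' : ((p : ℝ) - 3) ^ 8 * p ^ 4 ≤ c := by
      have : (((p - 3) ^ (2 * 4) * p ^ 4 : ℕ) : ℝ) ≤ c := by exact_mod_cast hlo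
      push_cast [h3] at this
      exact this
    have hhi' : (c : ℝ) ≤ (p : ℝ) ^ 12 := by exact_mod_cast hhi
    have hb8 := SLTwo.pow_mul_sub_le hq 8
    have hpε : 24 ≤ ε * p := by
      have h1 : 24 / ε ≤ p := (Nat.le_ceil _).trans (by exact_mod_cast (by omega))
      rw [div_le_iff₀ hε] at h1
      linarith
    have hp12 : (0 : ℝ) < (p : ℝ) ^ 12 := by positivity
    rw [abs_le]
    constructor
    · have : 1 - ε ≤ c / (p : ℝ) ^ 12 := by
        rw [le_div_iff₀ hp12]
        refine le_trans ?_ hlo'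
        have h4 : (0 : ℝ) < (p : ℝ) ^ 3 := by positivity
        have h11 : (0 : ℝ) < (p : ℝ) ^ 11 := by positivity
        push_cast at hb8
        have h5 := mul_le_mul_of_nonneg_right hb8 h4.le
        have h6 := mul_le_mul_of_nonneg_left hpε h11.le
        nlinarith
      linarith
    · have : c / (p : ℝ) ^ 12 ≤ 1 := (div_le_one hp12).2 hhi'
      linarith
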